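/- Let $\Omega$ be a circle of positive radius in the Euclidean plane (the \emph{absolute}). The \emph{h-plane} is the set of points inside $\Omega$. An \emph{h-line} is the intersection of the h-plane with a circle or line perpendicular to $\Omega$; through any two distinct points $P,Q$ of the h-plane there passes exactly one h-line. If $A,B\in\Omega$ are the two points where the circle or line containing this h-line meets $\Omega$, labelled so that $A,P,Q,B$ appear on it in this order, the \emph{h-distance} is $$PQ_h=\ln\frac{AQ\cdot BP}{QB\cdot PA},\qquad PP_h=0 .$$ The \emph{h-segment} from $P$ to $Q$ is the part of the h-line between $P$ and $Q$. For points $P\neq Q\neq R$ of the h-plane, the \emph{h-angle measure} $\measuredangle_h PQR\in(-\pi,\pi]$ is the signed measure of the Euclidean angle at $Q$ between the half-lines tangent at $Q$ to the h-segments from $Q$ to $P$ and from $Q$ to $R$. A \emph{motion} of the h-plane is a bijection of the h-plane onto itself that preserves the h-distance. An \emph{h-triangle} $\triangle_h ABC$ is an ordered triple of distinct points of the h-plane; it is \emph{nondegenerate} if $A,B,C$ do not lie on one h-line. Two h-triangles $\triangle_h ABC$ and $\triangle_h A'B'C'$ are \emph{congruent} if some motion $f$ of the h-plane satisfies $A'=f(A)$,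 $B'=f(B)$, $C'=f(C)$. \textbf{Theorem.} Let $\triangle_h ABC$ and $\triangle_h A'B'C'$ be two nondegenerate triangles in the h-plane such that $$\measuredangle_h ABC=\pm\measuredangle_h A'B'C',\qquad \measuredangle_h BCA=\pm\measuredangle_h B'C'A',\qquad \measuredangle_h CAB=\pm\measuredangle_h C'A'B',$$ where the sign may be chosen separately in each equality. Then $\triangle_h ABC$ and $\triangle_h A'B'C'$ are congruent. In particular, if $\triangle_h ABC$ and $\triangle_h A'B'C'$ are nondegenerate and similar, i.e. these angle equalities hold and for some $k>0$ one has $A'B'_h=k\cdot AB_h$, $B'C'_h=k\cdot BC_h$ and $C'A'_h=k\cdot CA_h$, then they are congruent. -/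

import Mathlib

open EuclideanGeometry

/-- A cline (circle or line) of the Euclidean plane, which is modelled by `ℂ`. -/
inductive Cline where
  | circle (c : Sphere ℂ) (hc : 0 < c.radius) : Cline
  | line (l : AffineSubspace ℝ ℂ) (hl : Module.finrank ℝ l.direction = 1) : Cline

namespace Cline

/-- The set of (finite) points of a cline. -/
def points : Cline → Set ℂ
  | circle c _ => (c : Set ℂ)
  | line l _ => (l : Set ℂ)

/-- The line tangent to a cline at one of its points `X`: the line through `X` orthogonal to the
radius for a circle, and the line itself for a line. -/
noncomputable def tangentLine : Cline → ℂ → AffineSubspace ℝ ℂ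
  | circle c _, X => c.orthRadius X
  | line l _, _ => l

/-- The cline `Γ` is perpendicular to the circle `Ω`: they meet at some point at which their tangent
lines are perpendicular. -/
def IsPerp (Γ : Cline) (Ω : Sphere ℂ) : Prop :=
  ∃ X : ℂ, X ∈ Γ.points ∧ X ∈ Ω ∧ (Γ.tangentLine X).direction ⟂ (Ω.orthRadius X).direction

end Cline

/-- The h-plane with absolute `Ω`: the set of all points inside `Ω`. -/
abbrev HPlane (Ω : Sphere ℂ) : Type := {X : ℂ // dist X Ω.center < Ω.radius}

namespace HPlane

/-- An h-line: the intersection of the h-plane with a cline perpendicular to the absolute. -/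
def IsHLine {Ω : Sphere ℂ} (s : Set (HPlane Ω)) : Prop :=
  ∃ Γ : Cline, Γ.IsPerp Ω ∧ s = {X : HPlane Ω | (X : ℂ) ∈ Γ.points}

lemma perp_circle {Ω c : Sphere ℂ} {hc : 0 < c.radius} (h : (Cline.circle c hc).IsPerp Ω) :
    (c.center.re - Ω.center.re) ^ 2 + (c.center.im - Ω.center.im) ^ 2
      = Ω.radius ^ 2 + c.radius ^ 2 := by
  obtain ⟨X, hX, hXΩ, hp⟩ := h
  have h1 : dist X c.center ^ 2 = c.radius ^ 2 := by
    rw [EuclideanGeometry.mem_sphere.1 (show X ∈ c from hX)]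
  have h2 : dist X Ω.center ^ 2 = Ω.radius ^ 2 := by
    rw [EuclideanGeometry.mem_sphere.1 hXΩ]
  rw [Complex.dist_eq, ← Complex.normSq_eq_norm_sq, Complex.normSq_apply] at h1 h2
  simp only [Cline.tangentLine, Sphere.direction_orthRadius, Submodule.isOrtho_iff_inner_eq,
    vsub_eq_sub] at hp
  have h3 := hp (Complex.I * (X - c.center))
    (by simp [Submodule.mem_orthogonal_singleton_iff_inner_right, Complex.inner]; ring)
    (Complex.I * (X - Ω.center))
    (by simp [Submodule.mem_orthogonal_singleton_iff_inner_right, Complex.inner]; ring)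
  simp [Complex.inner] at h1 h2 h3
  nlinarith

lemma perp_of_circle {Ω c : Sphere ℂ} (hc : 0 < c.radius) {X : ℂ} (h1 : X ∈ c) (h2 : X ∈ Ω)
    (h : (c.center.re - Ω.center.re) ^ 2 + (c.center.im - Ω.center.im) ^ 2
      = Ω.radius ^ 2 + c.radius ^ 2) (hΩ : 0 < Ω.radius) : (Cline.circle c hc).IsPerp Ω := by
  refine ⟨X, h1, h2, ?_⟩
  have e1 : dist X c.center ^ 2 = c.radius ^ 2 := by
    rw [EuclideanGeometry.mem_sphere.1 h1]
  have e2 : dist X Ω.center ^ 2 = Ω.radius ^ 2 := by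
    rw [EuclideanGeometry.mem_sphere.1 h2]
  rw [Complex.dist_eq, ← Complex.normSq_eq_norm_sq, Complex.normSq_apply] at e1 e2
  simp only [Cline.tangentLine, Sphere.direction_orthRadius, Submodule.isOrtho_iff_inner_eq,
    vsub_eq_sub, Submodule.mem_orthogonal_singleton_iff_inner_right]
  intro u hu v hv
  simp only [Complex.inner, Complex.mul_re, Complex.conj_re, Complex.conj_im, Complex.sub_re,
    Complex.sub_im] at *
  set a := X.re - c.center.re with ha
  set b := X.im - c.center.im with hb
  set a' := X.re - Ω.center.re with ha'
  set b' := X.im - Ω.center.im with hb'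
  have h0 : a * a' + b * b' = 0 := by nlinarith
  have hu' : a * u.re + b * u.im = 0 := by linarith
  have hv' : a' * v.re + b' * v.im = 0 := by linarith
  have hs : (0 : ℝ) < c.radius ^ 2 * Ω.radius ^ 2 := by positivity
  rw [← e1, ← e2] at hs
  have key : (a * a + b * b) * (a' * a' + b' * b') * (u.re * v.re - -u.im * v.im) = 0 := by
    have t1 : (a * a + b * b) * u.re = -b * (a * u.im - b * u.re) := by linear_combination a * hu'
    have t2 : (a * a + b * b) * u.im = a * (a * u.im - b * u.re) := by linear_combination b * hu'
    have t3 : (a' * a' + b' * b') * v.re = -b' * (a' * v.im - b' * v.re) := by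
      linear_combination a' * hv'
    have t4 : (a' * a' + b' * b') * v.im = a' * (a' * v.im - b' * v.re) := by
      linear_combination b' * hv'
    calc _ = ((a * a + b * b) * u.re) * ((a' * a' + b' * b') * v.re)
          + ((a * a + b * b) * u.im) * ((a' * a' + b' * b') * v.im) := by ring
      _ = (a * u.im - b * u.re) * (a' * v.im - b' * v.re) * (a * a' + b * b') := by
          rw [t1, t2, t3, t4]; ring
      _ = 0 := by rw [h0, mul_zero]
  rcases mul_eq_zero.1 key with h | h
  · exact absurd h hs.ne'
  · linarith

lemma circle_inter {Ω c : Sphere ℂ} (hc : 0 < c.radius) (hΩ : 0 < Ω.radius)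
    (h : (c.center.re - Ω.center.re) ^ 2 + (c.center.im - Ω.center.im) ^ 2
      = Ω.radius ^ 2 + c.radius ^ 2) :
    ∃ A B : ℂ, A ≠ B ∧ (c : Set ℂ) ∩ (Ω : Set ℂ) = {A, B} := by
  have hn : (0 : ℝ) < Ω.radius ^ 2 + c.radius ^ 2 := by positivity
  have hm : ∀ (s : Sphere ℂ) (hs : 0 < s.radius) (X : ℂ), X ∈ s ↔
      (X.re - s.center.re) ^ 2 + (X.im - s.center.im) ^ 2 = s.radius ^ 2 := by
    intro s hs X
    rw [EuclideanGeometry.mem_sphere, ← sq_eq_sq₀ dist_nonneg hs.le, Complex.dist_eq,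
      ← Complex.normSq_eq_norm_sq, Complex.normSq_apply, Complex.sub_re, Complex.sub_im]
    simp only [sq]
  set r := Ω.radius
  set ρ := c.radius
  set n := r ^ 2 + ρ ^ 2
  set x := c.center.re - Ω.center.re with hx
  set y := c.center.im - Ω.center.im with hy
  refine ⟨⟨Ω.center.re + (r ^ 2 * x - r * ρ * y) / n, Ω.center.im + (r ^ 2 * y + r * ρ * x) / n⟩,
    ⟨Ω.center.re + (r ^ 2 * x + r * ρ * y) / n, Ω.center.im + (r ^ 2 * y - r * ρ * x) / n⟩, ?_, ?_⟩
  · intro h'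
    rw [Complex.ext_iff] at h'
    obtain ⟨h1, h2⟩ := h'
    simp only [add_right_inj, div_left_inj' hn.ne'] at h1 h2
    have : r * ρ ≠ 0 := by positivity
    have h3 : y = 0 := by
      have : r * ρ * y = 0 := by linarith
      simpa [‹r * ρ ≠ 0›] using this
    have h4 : x = 0 := by
      have : r * ρ * x = 0 := by linarith
      simpa [‹r * ρ ≠ 0›] using this
    rw [h3, h4] at h
    norm_num at h
    linarith
  · ext X
    simp only [Set.mem_inter_iff, Set.mem_insert_iff, Set.mem_singleton_iff, Complex.ext_iff]
    change X ∈ c ∧ X ∈ Ω ↔ _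
    rw [hm c hc, hm Ω hΩ]
    have ex : X.re - c.center.re = (X.re - Ω.center.re) - x := by rw [hx]; ring
    have ey : X.im - c.center.im = (X.im - Ω.center.im) - y := by rw [hy]; ring
    rw [ex, ey]
    have eq1 : ∀ t : ℝ, X.re = Ω.center.re + t / n ↔ (X.re - Ω.center.re) * n = t := by
      intro t
      rw [← sub_eq_iff_eq_add', eq_div_iff hn.ne']
    have eq2 : ∀ t : ℝ, X.im = Ω.center.im + t / n ↔ (X.im - Ω.center.im) * n = t := by
      intro t
      rw [← sub_eq_iff_eq_add', eq_div_iff hn.ne']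
    rw [eq1, eq1, eq2, eq2]
    set p := X.re - Ω.center.re
    set q := X.im - Ω.center.im
    have hnn : n = r ^ 2 + ρ ^ 2 := rfl
    clear_value p q x y n
    constructor
    · rintro ⟨h1, h2⟩
      have e1 : p * x + q * y = r ^ 2 := by
        linear_combination (-h1 + h2 + h + hnn) / 2
      have e2 : (p * y - q * x) ^ 2 = (r * ρ) ^ 2 := by
        linear_combination h2 * n + (p ^ 2 + q ^ 2) * h - (p * x + q * y + r ^ 2) * e1 + r^2 * hnn
      rcases sq_eq_sq_iff_eq_or_eq_neg.1 e2 with e | e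
      · right
        constructor
        · linear_combination x * e1 + y * e - p * h
        · linear_combination y * e1 - x * e - q * h
      · left
        constructor
        · linear_combination x * e1 + y * e - p * h
        · linear_combination y * e1 - x * e - q * h
    · have hn2 : n ^ 2 ≠ 0 := by positivity
      rintro (⟨h1, h2⟩ | ⟨h1, h2⟩)
      all_goals
        have e2 : p ^ 2 + q ^ 2 = r ^ 2 := by
          apply mul_left_cancel₀ hn2
          calc n ^ 2 * (p ^ 2 + q ^ 2) = (p * n) ^ 2 + (q * n) ^ 2 := by ring
            _ = r ^ 2 * (r ^ 2 + ρ ^ 2) * (x ^ 2 + y ^ 2) := by rw [h1, h2]; ring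
            _ = n ^ 2 * r ^ 2 := by rw [h, ← hnn]; ring
        refine ⟨?_, e2⟩
        have e1 : p * x + q * y = r ^ 2 := by
          apply mul_left_cancel₀ hn.ne'
          calc n * (p * x + q * y) = (p * n) * x + (q * n) * y := by ring
            _ = r ^ 2 * (x ^ 2 + y ^ 2) := by rw [h1, h2]; ring
            _ = n * r ^ 2 := by rw [h]; ring
        linear_combination e2 - 2 * e1 + h + hnn

lemma exists_unit {l : AffineSubspace ℝ ℂ} (hl : Module.finrank ℝ l.direction = 1) :
    ∃ u : ℂ, ‖u‖ = 1 ∧ l.direction = Submodule.span ℝ {u} := by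
  obtain ⟨⟨v, hv⟩, hv0, hs⟩ := finrank_eq_one_iff'.1 hl
  have hv0' : v ≠ 0 := fun h => hv0 (Subtype.ext h)
  have hn : ‖v‖ ≠ 0 := norm_ne_zero_iff.2 hv0'
  refine ⟨(‖v‖⁻¹ : ℝ) • v, by rw [norm_smul]; simp [hn], le_antisymm ?_ ?_⟩
  · intro w hw
    obtain ⟨t, ht⟩ := hs ⟨w, hw⟩
    refine Submodule.mem_span_singleton.2 ⟨t * ‖v‖, ?_⟩
    rw [smul_smul, mul_assoc, mul_inv_cancel₀ hn, mul_one]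
    exact congrArg Subtype.val ht
  · rw [Submodule.span_singleton_le_iff_mem]
    exact Submodule.smul_mem _ _ hv

lemma center_mem_of_perp_line {Ω : Sphere ℂ} {l : AffineSubspace ℝ ℂ}
    {hl : Module.finrank ℝ l.direction = 1} (h : (Cline.line l hl).IsPerp Ω) :
    Ω.center ∈ l := by
  obtain ⟨X, hX, hXΩ, hp⟩ := h
  obtain ⟨u, hu, hd⟩ := exists_unit hl
  simp only [Cline.tangentLine, Sphere.direction_orthRadius, vsub_eq_sub] at hp
  have h1 : l.direction ≤ Submodule.span ℝ {X - Ω.center} := by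
    have := Submodule.isOrtho_iff_le.1 hp
    rwa [Submodule.orthogonal_orthogonal] at this
  have h2 : u ∈ Submodule.span ℝ {X - Ω.center} := h1 (hd ▸ Submodule.mem_span_singleton_self u)
  obtain ⟨t, ht⟩ := Submodule.mem_span_singleton.1 h2
  have ht0 : t ≠ 0 := by
    rintro rfl
    simp [← ht] at hu
  have h3 : Ω.center - X ∈ l.direction := by
    rw [hd]
    refine Submodule.mem_span_singleton.2 ⟨-t⁻¹, ?_⟩
    rw [← ht, smul_smul, neg_mul, inv_mul_cancel₀ ht0]
    simp
  have := AffineSubspace.vadd_mem_of_mem_direction h3 (show X ∈ l from hX)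
  simpa using this

lemma line_inter {Ω : Sphere ℂ} {l : AffineSubspace ℝ ℂ} (hl : Module.finrank ℝ l.direction = 1)
    (hΩ : 0 < Ω.radius) (h : Ω.center ∈ l) :
    ∃ A B : ℂ, A ≠ B ∧ (l : Set ℂ) ∩ (Ω : Set ℂ) = {A, B} := by
  obtain ⟨u, hu, hd⟩ := exists_unit hl
  have hu0 : u ≠ 0 := by
    rintro rfl
    simp at hu
  refine ⟨Ω.center + Ω.radius • u, Ω.center - Ω.radius • u, ?_, ?_⟩
  · intro h'
    have : (2 * Ω.radius) • u = 0 := by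
      rw [mul_smul, two_smul]
      linear_combination h'
    rcases smul_eq_zero.1 this with h1 | h1
    · linarith
    · exact hu0 h1
  · ext X
    simp only [Set.mem_inter_iff, Set.mem_insert_iff, Set.mem_singleton_iff]
    change X ∈ l ∧ X ∈ Ω ↔ _
    rw [← AffineSubspace.vsub_left_mem_direction_iff_mem h X, hd, Submodule.mem_span_singleton,
      EuclideanGeometry.mem_sphere, dist_eq_norm, vsub_eq_sub]
    constructor
    · rintro ⟨⟨t, ht⟩, hn⟩
      have : |t| = Ω.radius := by
        rw [norm_sub_rev, ← ht, norm_smul, hu, mul_one] at hn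
        exact hn
      rcases abs_eq hΩ.le |>.1 this with e | e
      · right; rw [← e, ht]; ring
      · left
        have : Ω.radius = -t := by linarith
        rw [this, neg_smul, ht]; ring
    · rintro (rfl | rfl)
      · refine ⟨⟨-Ω.radius, by simp⟩, ?_⟩
        simp [norm_smul, hu, abs_of_pos hΩ, -Complex.real_smul]
      · refine ⟨⟨Ω.radius, by simp⟩, ?_⟩
        simp [norm_smul, hu, abs_of_pos hΩ, -Complex.real_smul]

lemma perp_of_line {Ω : Sphere ℂ} {l : AffineSubspace ℝ ℂ} (hl : Module.finrank ℝ l.direction = 1)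
    (hΩ : 0 < Ω.radius) (h : Ω.center ∈ l) : (Cline.line l hl).IsPerp Ω := by
  obtain ⟨A, B, -, hAB⟩ := line_inter hl hΩ h
  have hA : A ∈ (l : Set ℂ) ∩ (Ω : Set ℂ) := hAB ▸ Set.mem_insert _ _
  refine ⟨A, hA.1, hA.2, ?_⟩
  simp only [Cline.tangentLine, Sphere.direction_orthRadius, vsub_eq_sub]
  rw [Submodule.isOrtho_iff_le, Submodule.orthogonal_orthogonal]
  obtain ⟨u, hu, hd⟩ := exists_unit hl
  have h1 : A - Ω.center ∈ l.direction := AffineSubspace.vsub_mem_direction hA.1 h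
  rw [hd] at h1 ⊢
  obtain ⟨t, ht⟩ := Submodule.mem_span_singleton.1 h1
  have ht0 : t ≠ 0 := by
    rintro rfl
    have h2 : dist A Ω.center = Ω.radius := EuclideanGeometry.mem_sphere.1 hA.2
    rw [dist_eq_norm, ← ht] at h2
    simp at h2
    linarith
  rw [Submodule.span_singleton_le_iff_mem]
  refine Submodule.mem_span_singleton.2 ⟨t⁻¹, ?_⟩
  rw [← ht, smul_smul, inv_mul_cancel₀ ht0, one_smul]

lemma radius_pos {Ω : Sphere ℂ} (P : HPlane Ω) : 0 < Ω.radius :=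
  dist_nonneg.trans_lt P.2

lemma sq_lt {Ω : Sphere ℂ} (P : HPlane Ω) :
    ((P : ℂ).re - Ω.center.re) ^ 2 + ((P : ℂ).im - Ω.center.im) ^ 2 < Ω.radius ^ 2 := by
  have := (sq_lt_sq₀ dist_nonneg (radius_pos P).le).2 P.2
  rw [Complex.dist_eq, ← Complex.normSq_eq_norm_sq, Complex.normSq_apply, Complex.sub_re,
    Complex.sub_im] at this
  simpa only [sq] using this

lemma cline_aux {p p' x y r : ℝ} (hP : p ^ 2 + p' ^ 2 < r ^ 2)
    (e1 : 2 * (p * x + p' * y) = p ^ 2 + p' ^ 2 + r ^ 2) : 0 < x ^ 2 + y ^ 2 - r ^ 2 := by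
  have h6 : 0 ≤ p ^ 2 + p' ^ 2 := by positivity
  have h5 : 0 < (r ^ 2 - (p ^ 2 + p' ^ 2)) ^ 2 := pow_pos (sub_pos.2 hP) 2
  have h8 : 0 ≤ (p * y - p' * x) ^ 2 := sq_nonneg _
  have h9 : 4 * (p ^ 2 + p' ^ 2) * (x ^ 2 + y ^ 2)
      = (p ^ 2 + p' ^ 2 + r ^ 2) ^ 2 + 4 * (p * y - p' * x) ^ 2 := by
    rw [← e1]; ring
  by_contra hcon
  have h7 := mul_le_mul_of_nonneg_left (show x ^ 2 + y ^ 2 ≤ r ^ 2 by linarith) h6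
  linarith

lemma tangent_aux {a b a' b' x y r ρ : ℝ} (hr : 0 < ρ ^ 2)
    (hQ2 : a ^ 2 + b ^ 2 = ρ ^ 2) (hP2 : a' ^ 2 + b' ^ 2 = ρ ^ 2)
    (hcen : x ^ 2 + y ^ 2 = r ^ 2 + ρ ^ 2) (hQ1 : (a + x) ^ 2 + (b + y) ^ 2 < r ^ 2)
    (hP1 : (a' + x) ^ 2 + (b' + y) ^ 2 < r ^ 2) (hx0 : a * b' = b * a') : a' = a ∧ b' = b := by
  have h1 : (a * a' + b * b') ^ 2 = (ρ ^ 2) ^ 2 := by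
    linear_combination (a' ^ 2 + b' ^ 2) * hQ2 + ρ ^ 2 * hP2 - (a * b' - b * a') * hx0
  rcases sq_eq_sq_iff_eq_or_eq_neg.1 h1 with h2 | h2
  · have h3 : (a' - a) ^ 2 + (b' - b) ^ 2 = 0 := by linear_combination hP2 + hQ2 - 2 * h2
    have h4 : a' - a = 0 := pow_eq_zero_iff two_ne_zero |>.1
      (le_antisymm (by linarith [sq_nonneg (b' - b)]) (sq_nonneg _))
    have h5 : b' - b = 0 := pow_eq_zero_iff two_ne_zero |>.1
      (le_antisymm (by linarith [sq_nonneg (a' - a)]) (sq_nonneg _))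
    exact ⟨by linarith, by linarith⟩
  · have h3 : (a' + a) ^ 2 + (b' + b) ^ 2 = 0 := by linear_combination hP2 + hQ2 + 2 * h2
    have h4 : a' + a = 0 := pow_eq_zero_iff two_ne_zero |>.1
      (le_antisymm (by linarith [sq_nonneg (b' + b)]) (sq_nonneg _))
    have h5 : b' + b = 0 := pow_eq_zero_iff two_ne_zero |>.1
      (le_antisymm (by linarith [sq_nonneg (a' + a)]) (sq_nonneg _))
    rw [eq_neg_of_add_eq_zero_left h4, eq_neg_of_add_eq_zero_left h5] at hP1
    linarith

/-- Through any two points of the h-plane there passes a cline perpendicular to the absolute. -/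
lemma exists_cline {Ω : Sphere ℂ} {P Q : HPlane Ω} (hPQ : P ≠ Q) :
    ∃ Γ : Cline, Γ.IsPerp Ω ∧ (P : ℂ) ∈ Γ.points ∧ (Q : ℂ) ∈ Γ.points := by
  have hΩ := radius_pos P
  have hP := sq_lt P
  have hPQ' : (P : ℂ) ≠ Q := fun h => hPQ (Subtype.ext h)
  obtain ⟨P, hP'⟩ := P
  obtain ⟨Q, hQ'⟩ := Q
  simp only at *
  by_cases hdet : (P.re - Ω.center.re) * (Q.im - Ω.center.im)
      - (P.im - Ω.center.im) * (Q.re - Ω.center.re) = 0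
  · have hl : Module.finrank ℝ (AffineSubspace.mk' P (Submodule.span ℝ {Q - P})).direction = 1 := by
      rw [AffineSubspace.direction_mk', finrank_span_singleton (sub_ne_zero.2 hPQ'.symm)]
    refine ⟨Cline.line _ hl, perp_of_line hl hΩ ?_, AffineSubspace.self_mem_mk' _ _, ?_⟩
    · rw [AffineSubspace.mem_mk', Submodule.mem_span_singleton]
      have hn : (0 : ℝ) < Complex.normSq (Q - P) := Complex.normSq_pos.2 (sub_ne_zero.2 hPQ'.symm)
      refine ⟨((Ω.center.re - P.re) * (Q.re - P.re) + (Ω.center.im - P.im) * (Q.im - P.im))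
        / Complex.normSq (Q - P), ?_⟩
      have hd : (Ω.center.re - P.re) * (Q.im - P.im) = (Ω.center.im - P.im) * (Q.re - P.re) := by
        linarith
      rw [div_eq_inv_mul, mul_smul, inv_smul_eq_iff₀ hn.ne']
      simp only [Complex.normSq_apply]
      apply Complex.ext
      · simp
        linear_combination -(Q.im - P.im) * hd
      · simp
        linear_combination (Q.re - P.re) * hd
    · change Q ∈ AffineSubspace.mk' P _
      rw [AffineSubspace.mem_mk']
      exact Submodule.mem_span_singleton_self _
  · set p := P.re - Ω.center.re with hp
    set p' := P.im - Ω.center.im with hp'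
    set q := Q.re - Ω.center.re with hq
    set q' := Q.im - Ω.center.im with hq'
    set r := Ω.radius with hr
    set D := p * q' - p' * q with hD
    set S := p ^ 2 + p' ^ 2 + r ^ 2 with hS
    set T := q ^ 2 + q' ^ 2 + r ^ 2 with hT
    set x := (S * q' - T * p') / (2 * D) with hx
    set y := (T * p - S * q) / (2 * D) with hy
    have e1 : 2 * (p * x + p' * y) = S := by
      rw [hx, hy]; field_simp; rw [hD]; ring
    have e2 : 2 * (q * x + q' * y) = T := by
      rw [hx, hy]; field_simp; rw [hD]; ring
    have hpos : 0 < x ^ 2 + y ^ 2 - r ^ 2 := by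
      exact cline_aux hP (by rw [← hS]; exact e1)
    obtain ⟨c, hc⟩ : ∃ c : Sphere ℂ,
        c = ⟨⟨Ω.center.re + x, Ω.center.im + y⟩, √(x ^ 2 + y ^ 2 - r ^ 2)⟩ := ⟨_, rfl⟩
    have hcr : 0 < c.radius := by rw [hc]; exact Real.sqrt_pos.2 hpos
    have hcr2 : c.radius ^ 2 = x ^ 2 + y ^ 2 - r ^ 2 := by rw [hc]; exact Real.sq_sqrt hpos.le
    have hcen : (c.center.re - Ω.center.re) ^ 2 + (c.center.im - Ω.center.im) ^ 2
      = Ω.radius ^ 2 + c.radius ^ 2 := by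
      rw [hcr2, hc]; simp; ring
    obtain ⟨A, B, -, hAB⟩ := circle_inter hcr hΩ hcen
    have hA : A ∈ (c : Set ℂ) ∩ (Ω : Set ℂ) := hAB ▸ Set.mem_insert _ _
    have hm : ∀ X : ℂ, (X.re - c.center.re) ^ 2 + (X.im - c.center.im) ^ 2 = c.radius ^ 2 →
        X ∈ (c : Set ℂ) := by
      intro X hX
      change X ∈ c
      rw [EuclideanGeometry.mem_sphere, ← sq_eq_sq₀ dist_nonneg hcr.le, Complex.dist_eq,
        ← Complex.normSq_eq_norm_sq, Complex.normSq_apply, Complex.sub_re, Complex.sub_im, ← hX]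
      ring
    refine ⟨Cline.circle c hcr, perp_of_circle hcr hA.1 hA.2 hcen hΩ, hm _ ?_, hm _ ?_⟩
    · have e3 : P.re - c.center.re = p - x := by rw [hc]; simp; ring
      have e4 : P.im - c.center.im = p' - y := by rw [hc]; simp; ring
      rw [e3, e4, hcr2]
      linear_combination hS - e1
    · have e3 : Q.re - c.center.re = q - x := by rw [hc]; simp; ring
      have e4 : Q.im - c.center.im = q' - y := by rw [hc]; simp; ring
      rw [e3, e4, hcr2]
      linear_combination hT - e2

/-- A cline perpendicular to the absolute meets it in exactly two points. -/
lemma exists_ideal {Ω : Sphere ℂ} {Γ : Cline} (hΩ : 0 < Ω.radius) (h : Γ.IsPerp Ω) :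
    ∃ A B : ℂ, A ≠ B ∧ Γ.points ∩ (Ω : Set ℂ) = {A, B} := by
  match Γ, h with
  | .circle c hc, h => exact circle_inter hc hΩ (perp_circle h)
  | .line l hl, h => exact line_inter hl hΩ (center_mem_of_perp_line h)

/-- For points `P ≠ Q` on a cline perpendicular to the absolute, the tangent line at `Q` has a
direction that makes an acute angle with the chord from `Q` to `P`. -/
lemma exists_tangent {Ω : Sphere ℂ} {P Q : HPlane Ω} (hPQ : P ≠ Q) {Γ : Cline} (h : Γ.IsPerp Ω)
    (hP : (P : ℂ) ∈ Γ.points) (hQ : (Q : ℂ) ∈ Γ.points) :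
    ∃ v : ℂ, v ∈ (Γ.tangentLine Q).direction ∧ 0 < inner ℝ v ((P : ℂ) - Q) := by
  have hPQ' : (P : ℂ) ≠ Q := fun h => hPQ (Subtype.ext h)
  match Γ, h with
  | .line l hl, _ =>
    exact ⟨(P : ℂ) - Q, AffineSubspace.vsub_mem_direction hP hQ,
      real_inner_self_pos.2 (sub_ne_zero.2 hPQ')⟩
  | .circle c hc, h =>
    have hcen := perp_circle h
    have hP1 := sq_lt P
    have hQ1 := sq_lt Q
    have hm : ∀ X : ℂ, X ∈ c → (X.re - c.center.re) ^ 2 + (X.im - c.center.im) ^ 2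
        = c.radius ^ 2 := by
      intro X hX
      rw [EuclideanGeometry.mem_sphere, ← sq_eq_sq₀ dist_nonneg hc.le, Complex.dist_eq,
        ← Complex.normSq_eq_norm_sq, Complex.normSq_apply, Complex.sub_re, Complex.sub_im] at hX
      rw [← hX]
      ring
    have hP2 := hm _ hP
    have hQ2 := hm _ hQ
    generalize (P : ℂ) = P at *
    generalize (Q : ℂ) = Q at *
    have hne : inner ℝ (Complex.I * (Q - c.center)) (P - Q) ≠ 0 := by
      intro h0
      simp only [Complex.inner, Complex.mul_re, Complex.mul_im, Complex.conj_re, Complex.conj_im,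
        Complex.sub_re, Complex.sub_im, Complex.I_re, Complex.I_im] at h0
      obtain ⟨h1, h2⟩ := tangent_aux (pow_pos hc 2) hQ2 hP2 hcen
        (by rw [sub_add_sub_cancel, sub_add_sub_cancel]; exact hQ1)
        (by rw [sub_add_sub_cancel, sub_add_sub_cancel]; exact hP1) (by linarith)
      exact hPQ' (Complex.ext (by linarith) (by linarith))
    have hmem : ∀ s : ℝ, s • (Complex.I * (Q - c.center)) ∈
        ((Cline.circle c hc).tangentLine Q).direction := by
      intro s
      refine Submodule.smul_mem _ _ ?_
      simp only [Cline.tangentLine, Sphere.direction_orthRadius, vsub_eq_sub,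
        Submodule.mem_orthogonal_singleton_iff_inner_right]
      simp [Complex.inner]
      ring
    refine ⟨_, hmem (inner ℝ (Complex.I * (Q - c.center)) (P - Q)), ?_⟩
    rw [real_inner_smul_left]
    exact mul_self_pos.2 hne

/-- The cline perpendicular to the absolute through two distinct points of the h-plane. -/
noncomputable def hCline {Ω : Sphere ℂ} (P Q : HPlane Ω) (h : P ≠ Q) : Cline :=
  (exists_cline h).choose

lemma hCline_spec {Ω : Sphere ℂ} (P Q : HPlane Ω) (h : P ≠ Q) : (hCline P Q h).IsPerp Ω ∧
    (P : ℂ) ∈ (hCline P Q h).points ∧ (Q : ℂ) ∈ (hCline P Q h).points :=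
  (exists_cline h).choose_spec

/-- One of the two ideal points of the h-line through `P` and `Q`. -/
noncomputable def idealA {Ω : Sphere ℂ} (P Q : HPlane Ω) (h : P ≠ Q) : ℂ :=
  (exists_ideal (radius_pos P) (hCline_spec P Q h).1).choose

/-- The other ideal point of the h-line through `P` and `Q`. -/
noncomputable def idealB {Ω : Sphere ℂ} (P Q : HPlane Ω) (h : P ≠ Q) : ℂ :=
  (exists_ideal (radius_pos P) (hCline_spec P Q h).1).choose_spec.choose

/-- The two points `idealA` and `idealB` are distinct, and they are exactly the intersection points
of the absolute with the cline that contains the h-line through `P` and `Q`. -/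
lemma ideal_spec {Ω : Sphere ℂ} (P Q : HPlane Ω) (h : P ≠ Q) : idealA P Q h ≠ idealB P Q h ∧
    (hCline P Q h).points ∩ (Ω : Set ℂ) = {idealA P Q h, idealB P Q h} :=
  (exists_ideal (radius_pos P) (hCline_spec P Q h).1).choose_spec.choose_spec

open Classical in
/-- The h-distance. For `P ≠ Q` it is the logarithm of the cross-ratio `(AQ · BP) / (QB · PA)`, where
`A`, `B` are the ideal points of the h-line through `P` and `Q`, labelled so that `A`, `P`, `Q`, `B`
appear in this order. For this labelling the cross-ratio is at least one and exchanging `A` and `B`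
inverts it, so for an arbitrary labelling one takes the absolute value of the logarithm. -/
noncomputable def hDist {Ω : Sphere ℂ} (P Q : HPlane Ω) : ℝ :=
  if h : P = Q then 0
  else |Real.log ((dist (idealA P Q h) Q * dist (idealB P Q h) P) /
    (dist (Q : ℂ) (idealB P Q h) * dist (P : ℂ) (idealA P Q h)))|

open Classical in
/-- For `P ≠ Q`, a vector spanning the Euclidean half-line that starts at `Q` and is tangent to the
h-segment from `Q` to `P`. It lies in the tangent line at `Q` of the cline through `P` and `Q`. Since
an h-segment is a Euclidean segment or a circle arc shorter than a semicircle, the tangent half-line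
is the one making an acute angle with the chord from `Q` to `P`. -/
noncomputable def hTangent {Ω : Sphere ℂ} (Q P : HPlane Ω) : ℂ :=
  if h : P = Q then 0
  else (exists_tangent h (hCline_spec P Q h).1 (hCline_spec P Q h).2.1
    (hCline_spec P Q h).2.2).choose

/-- The h-angle measure of the angle `PQR` with vertex `Q`: the signed measure, in `(-π, π]`, of the
Euclidean angle from the tangent half-line towards `P` to the tangent half-line towards `R`. -/
noncomputable def hAngle {Ω : Sphere ℂ} (P Q R : HPlane Ω) : ℝ :=
  Complex.arg (hTangent Q R / hTangent Q P)

/-- Three points form a nondegenerate h-triangle: they are distinct and lie on no h-line. -/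
def IsNondegenerate {Ω : Sphere ℂ} (A B C : HPlane Ω) : Prop :=
  A ≠ B ∧ B ≠ C ∧ C ≠ A ∧ ¬ ∃ s : Set (HPlane Ω), IsHLine s ∧ A ∈ s ∧ B ∈ s ∧ C ∈ s

/-- A motion of the h-plane: a bijection of the h-plane onto itself preserving the h-distance. -/
def IsMotion {Ω : Sphere ℂ} (f : HPlane Ω → HPlane Ω) : Prop :=
  Function.Bijective f ∧ ∀ P Q, hDist (f P) (f Q) = hDist P Q

/-- Congruence of the h-triangles `ABC` and `A'B'C'`: some motion sends `A`, `B`, `C` to `A'`, `B'`,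
`C'` respectively. -/
def IsCongruent {Ω : Sphere ℂ} (A B C A' B' C' : HPlane Ω) : Prop :=
  ∃ f : HPlane Ω → HPlane Ω, IsMotion f ∧ A' = f A ∧ B' = f B ∧ C' = f C

/-- The corresponding angle measures of `ABC` and `A'B'C'` are equal up to sign, each with its own
sign. -/
def SameAngles {Ω : Sphere ℂ} (A B C A' B' C' : HPlane Ω) : Prop :=
  (hAngle A B C = hAngle A' B' C' ∨ hAngle A B C = -hAngle A' B' C') ∧
  (hAngle B C A = hAngle B' C' A' ∨ hAngle B C A = -hAngle B' C' A') ∧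
  (hAngle C A B = hAngle C' A' B' ∨ hAngle C A B = -hAngle C' A' B')

/-- Similarity of h-triangles: the sides are proportional and corresponding angle measures are equal
up to sign. -/
def IsSimilar {Ω : Sphere ℂ} (A B C A' B' C' : HPlane Ω) : Prop :=
  (∃ k : ℝ, 0 < k ∧ hDist A' B' = k * hDist A B ∧ hDist B' C' = k * hDist B C ∧
    hDist C' A' = k * hDist C A) ∧ SameAngles A B C A' B' C'

end HPlane

/-! After rescaling `Ω` to the unit circle, `mob a` carries the vertex `a` to the centre, where
h-lines are diameters. It is conformal with positive derivative at `a`, so the tangent from `a`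
towards `z` has the direction of `mob a z` (`exists_hTangent_eq`), and an h-angle is the argument of
a quotient of two such values (`hAngle_eq`). With `t = ‖mob p q‖` the h-distance is `log ((1 + t) /
(1 - t))` (`hDist_eq`). Passing to cosines removes the sign ambiguity of the angles. The hyperbolic
law of cosines (`discCosh_eq`), applied at all three vertices, yields the dual law (`dual_cos`): the
cosh of a side is a function of the three angle cosines, provided the sines of the two adjacent
angles do not vanish, which is what nondegeneracy gives (`perpDet_ne_zero`, `discCos_sq_ne_one`).
Equal angles therefore force equal sides; no similarity with ratio other than 1 exists. It remains
to use side-angle-side (`isCongruent_of_discCos_eq`): with `A` and `A'` moved to the centre, a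
rotation or reflection matches the other two vertices, and all these maps are motions. -/

open ComplexConjugate

/-! ### Möbius transformations of the unit disc -/

/-- The Möbius transformation of the unit disc that sends `a` to `0`. -/
noncomputable def mob (a z : ℂ) : ℂ := (z - a) / (1 - conj a * z)

lemma one_sub_conj_mul_ne_zero {a z : ℂ} (ha : ‖a‖ < 1) (hz : ‖z‖ ≤ 1) : 1 - conj a * z ≠ 0 := by
  intro h
  have h1 : ‖conj a * z‖ = 1 := by rw [← sub_eq_zero.1 h, norm_one]
  rw [norm_mul, RCLike.norm_conj] at h1
  nlinarith [norm_nonneg a, norm_nonneg z]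

lemma one_sub_conj_mul_self_ne_zero {a : ℂ} (ha : ‖a‖ < 1) : 1 - conj a * a ≠ 0 :=
  one_sub_conj_mul_ne_zero ha ha.le

lemma sub_mul_conj_ne_zero {a z : ℂ} (ha : ‖a‖ < 1) (hz : ‖z‖ ≤ 1) : 1 - a * conj z ≠ 0 := by
  have := one_sub_conj_mul_ne_zero (a := conj a) (z := conj z) (by simpa using ha) (by simpa using hz)
  simpa using this

/-- Differences pick up one factor per point, and these factors cancel in cross-ratios. Together
with the companion formula `one_sub_conj_mob_mul_mob`, this gives the invariance of `‖mob z w‖`. -/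
lemma mob_sub_mob {a z w : ℂ} (ha : ‖a‖ < 1) (hz : ‖z‖ ≤ 1) (hw : ‖w‖ ≤ 1) :
    mob a z - mob a w = (z - w) * (1 - conj a * a) / ((1 - conj a * z) * (1 - conj a * w)) := by
  have h1 := one_sub_conj_mul_ne_zero ha hz
  have h2 := one_sub_conj_mul_ne_zero ha hw
  unfold mob
  rw [div_sub_div _ _ h1 h2]
  ring

lemma one_sub_conj_mob_mul_mob {a z w : ℂ} (ha : ‖a‖ < 1) (hz : ‖z‖ ≤ 1) (hw : ‖w‖ ≤ 1) :
    1 - conj (mob a z) * mob a w =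
      (1 - conj a * a) * (1 - conj z * w) / ((1 - a * conj z) * (1 - conj a * w)) := by
  have h1 := sub_mul_conj_ne_zero ha hz
  have h2 := one_sub_conj_mul_ne_zero ha hw
  simp only [mob, map_div₀, map_sub, map_mul, map_one, Complex.conj_conj]
  rw [div_mul_div_comm, one_sub_div (mul_ne_zero h1 h2)]
  ring

lemma norm_one_sub_mul_conj (a z : ℂ) : ‖1 - a * conj z‖ = ‖1 - conj a * z‖ := by
  rw [← RCLike.norm_conj]
  simp

/-- This is `‖1 - conj a * z‖² - ‖z - a‖² = (1 - ‖a‖²)(1 - ‖z‖²)` after division. It shows that the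
disc and its boundary circle are mapped into themselves, and later evaluates `discCosh` in the law
of cosines. -/
lemma one_sub_norm_mob_sq {a z : ℂ} (ha : ‖a‖ < 1) (hz : ‖z‖ ≤ 1) :
    1 - ‖mob a z‖ ^ 2 = (1 - ‖a‖ ^ 2) * (1 - ‖z‖ ^ 2) / ‖1 - conj a * z‖ ^ 2 := by
  have h2 := norm_ne_zero_iff.2 (one_sub_conj_mul_ne_zero ha hz)
  rw [mob, norm_div, div_pow, one_sub_div (pow_ne_zero 2 h2)]
  congr 1
  simp only [← Complex.normSq_eq_norm_sq, Complex.normSq_apply, Complex.sub_re, Complex.sub_im,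
    Complex.mul_re, Complex.mul_im, Complex.conj_re, Complex.conj_im, Complex.one_re,
    Complex.one_im]
  ring

lemma norm_mob_lt_one {a z : ℂ} (ha : ‖a‖ < 1) (hz : ‖z‖ < 1) : ‖mob a z‖ < 1 := by
  have h2 := norm_pos_iff.2 (one_sub_conj_mul_ne_zero ha hz.le)
  have h : 0 < 1 - ‖mob a z‖ ^ 2 := by
    rw [one_sub_norm_mob_sq ha hz.le]
    have := pow_lt_one₀ (norm_nonneg a) ha two_ne_zero
    have := pow_lt_one₀ (norm_nonneg z) hz two_ne_zero
    apply div_pos (mul_pos _ _) (by positivity) <;> linarith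
  nlinarith [norm_nonneg (mob a z)]

lemma norm_mob_eq_one {a z : ℂ} (ha : ‖a‖ < 1) (hz : ‖z‖ = 1) : ‖mob a z‖ = 1 := by
  have h := one_sub_norm_mob_sq ha hz.le
  rw [hz] at h
  norm_num at h
  nlinarith [norm_nonneg (mob a z)]

lemma mob_neg_mob {a z : ℂ} (ha : ‖a‖ < 1) (hz : ‖z‖ ≤ 1) : mob (-a) (mob a z) = z := by
  have h1 := one_sub_conj_mul_ne_zero ha hz
  have h2 := one_sub_conj_mul_self_ne_zero ha
  have h3 : 1 + conj a * mob a z = (1 - conj a * a) / (1 - conj a * z) := by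
    rw [mob, mul_div_assoc', one_add_div h1]
    ring
  have h4 : mob a z + a = (1 - conj a * a) * z / (1 - conj a * z) := by
    rw [mob, div_add' _ _ _ h1]
    ring
  rw [mob, map_neg, sub_neg_eq_add, neg_mul, sub_neg_eq_add, h3, h4, div_div_div_cancel_right₀ h1, mul_div_cancel_left₀ _ h2]

lemma mob_self (a : ℂ) : mob a a = 0 := by simp [mob]

lemma mob_ne_zero {a z : ℂ} (ha : ‖a‖ < 1) (hz : ‖z‖ ≤ 1) (h : a ≠ z) : mob a z ≠ 0 :=
  div_ne_zero (sub_ne_zero.2 h.symm) (one_sub_conj_mul_ne_zero ha hz)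

lemma norm_mob_comm (a z : ℂ) : ‖mob a z‖ = ‖mob z a‖ := by
  rw [mob, mob, norm_div, norm_div, norm_sub_rev, ← norm_one_sub_mul_conj z a, mul_comm z]

/-- Möbius transformations preserve the pseudo-hyperbolic distance. -/
lemma norm_mob_mob {a z w : ℂ} (ha : ‖a‖ < 1) (hz : ‖z‖ < 1) (hw : ‖w‖ < 1) :
    ‖mob (mob a z) (mob a w)‖ = ‖mob z w‖ := by
  have h1 := norm_ne_zero_iff.2 (one_sub_conj_mul_ne_zero ha hz.le)
  have h2 := norm_ne_zero_iff.2 (one_sub_conj_mul_ne_zero ha hw.le)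
  have h3 := norm_ne_zero_iff.2 (one_sub_conj_mul_self_ne_zero ha)
  have h4 := norm_ne_zero_iff.2 (one_sub_conj_mul_ne_zero hz hw.le)
  rw [mob, mob_sub_mob ha hw.le hz.le, one_sub_conj_mob_mul_mob ha hz.le hw.le, mob]
  simp only [norm_div, norm_mul, norm_one_sub_mul_conj]
  rw [mul_comm ‖1 - conj a * w‖, norm_sub_rev w z, div_div_div_eq]
  generalize ‖1 - conj a * a‖ = x₁ at *
  generalize ‖1 - conj a * z‖ = x₂ at *
  generalize ‖1 - conj a * w‖ = x₃ at *
  generalize ‖1 - conj z * w‖ = x₄ at *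
  field_simp

/-- The pseudo-hyperbolic distance is invariant under linear isometries. -/
lemma norm_mob_map (T : ℂ ≃ₗᵢ[ℝ] ℂ) (z w : ℂ) :
    ‖mob (T z) (T w)‖ = ‖mob z w‖ := by
  -- The denominator is rewritten through lengths only, so that orientation-reversing isometries are
  -- covered along with rotations.
  have key : ∀ z w : ℂ, ‖1 - conj z * w‖ ^ 2 = ‖z - w‖ ^ 2 + (1 - ‖z‖ ^ 2) * (1 - ‖w‖ ^ 2) := by
    intro z w
    simp only [← Complex.normSq_eq_norm_sq, Complex.normSq_apply, Complex.sub_re, Complex.sub_im,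
      Complex.mul_re, Complex.mul_im, Complex.conj_re, Complex.conj_im, Complex.one_re,
      Complex.one_im]
    ring
  have h : ‖1 - conj (T z) * T w‖ = ‖1 - conj z * w‖ := by
    rw [← sq_eq_sq₀ (norm_nonneg _) (norm_nonneg _), key, key, ← map_sub]
    simp only [LinearIsometryEquiv.norm_map]
  rw [mob, mob, norm_div, norm_div, h, ← map_sub, LinearIsometryEquiv.norm_map]

/-! ### Hyperbolic trigonometry in the disc -/

/-- The hyperbolic cosine of the hyperbolic distance of two points of the unit disc. -/
noncomputable def discCosh (z w : ℂ) : ℝ := (1 + ‖mob z w‖ ^ 2) / (1 - ‖mob z w‖ ^ 2)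

/-- The hyperbolic sine of the hyperbolic distance of two points of the unit disc. -/
noncomputable def discSinh (z w : ℂ) : ℝ := 2 * ‖mob z w‖ / (1 - ‖mob z w‖ ^ 2)

/-- The cosine of the hyperbolic angle at `a` between the directions to `b` and `c`. -/
noncomputable def discCos (a b c : ℂ) : ℝ := (mob a c / mob a b).re / ‖mob a c / mob a b‖

lemma one_sub_norm_mob_sq_pos {a z : ℂ} (ha : ‖a‖ < 1) (hz : ‖z‖ < 1) : 0 < 1 - ‖mob a z‖ ^ 2 :=
  sub_pos.2 (pow_lt_one₀ (norm_nonneg _) (norm_mob_lt_one ha hz) two_ne_zero)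

lemma discCosh_comm (z w : ℂ) : discCosh z w = discCosh w z := by
  rw [discCosh, discCosh, norm_mob_comm]

lemma discSinh_comm (z w : ℂ) : discSinh z w = discSinh w z := by
  rw [discSinh, discSinh, norm_mob_comm]

lemma discCosh_pos {z w : ℂ} (hz : ‖z‖ < 1) (hw : ‖w‖ < 1) : 0 < discCosh z w :=
  div_pos (by positivity) (one_sub_norm_mob_sq_pos hz hw)

lemma discSinh_pos {z w : ℂ} (hz : ‖z‖ < 1) (hw : ‖w‖ < 1) (h : z ≠ w) : 0 < discSinh z w :=
  div_pos (mul_pos two_pos (norm_pos_iff.2 (mob_ne_zero hz hw.le h)))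
    (one_sub_norm_mob_sq_pos hz hw)

lemma discSinh_sq {z w : ℂ} (hz : ‖z‖ < 1) (hw : ‖w‖ < 1) :
    discSinh z w ^ 2 = discCosh z w ^ 2 - 1 := by
  have := (one_sub_norm_mob_sq_pos hz hw).ne'
  rw [discSinh, discCosh]
  field_simp
  ring

/-- The function `(1 + s) / (1 - s)` is injective in `s = ‖mob z w‖²`. -/
lemma norm_mob_eq_of_discCosh_eq {z w z' w' : ℂ} (hz : ‖z‖ < 1) (hw : ‖w‖ < 1) (hz' : ‖z'‖ < 1)
    (hw' : ‖w'‖ < 1) (h : discCosh z w = discCosh z' w') : ‖mob z w‖ = ‖mob z' w'‖ := by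
  rw [discCosh, discCosh, div_eq_div_iff (one_sub_norm_mob_sq_pos hz hw).ne'
    (one_sub_norm_mob_sq_pos hz' hw').ne'] at h
  rw [← sq_eq_sq₀ (norm_nonneg _) (norm_nonneg _)]
  linarith

/-- The hyperbolic law of cosines. -/
lemma discCosh_eq {a b c : ℂ} (ha : ‖a‖ < 1) (hb : ‖b‖ < 1) (hc : ‖c‖ < 1) (hab : a ≠ b)
    (hac : a ≠ c) : discCosh b c =
      discCosh a b * discCosh a c - discSinh a b * discSinh a c * discCos a b c := by
  -- With `a` at the centre, the sides from `a` are radii of lengths `‖mob a b‖` and `‖mob a c‖`,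
  -- and the angle is Euclidean. Below, `1 + t` is written as `2 - (1 - t)` so that
  -- `one_sub_norm_mob_sq` treats numerator and denominator alike.
  have e : discCosh b c = discCosh (mob a b) (mob a c) := by
    rw [discCosh, discCosh, norm_mob_mob ha hb hc]
  have hz := norm_mob_lt_one ha hb
  have hw := norm_mob_lt_one ha hc
  have hz0 := mob_ne_zero ha hb.le hab
  have hw0 := mob_ne_zero ha hc.le hac
  rw [e, discCosh, one_sub_norm_mob_sq hz hw.le, show ∀ t : ℝ, 1 + t = 2 - (1 - t) by intro; ring,
    one_sub_norm_mob_sq hz hw.le, discCosh, discCosh, discSinh, discSinh, discCos]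
  have h1 := one_sub_norm_mob_sq_pos ha hb
  have h2 := one_sub_norm_mob_sq_pos ha hc
  have h3 := norm_pos_iff.2 (one_sub_conj_mul_ne_zero hz hw.le)
  generalize mob a b = z at *
  generalize mob a c = w at *
  have hz1 := norm_pos_iff.2 hz0
  have hw1 := norm_pos_iff.2 hw0
  have e1 : (w / z).re / ‖w / z‖ = (z.re * w.re + z.im * w.im) / (‖z‖ * ‖w‖) := by
    rw [norm_div, Complex.div_re, Complex.normSq_eq_norm_sq]
    field_simp
  have e2 : ‖1 - conj z * w‖ ^ 2 = 1 - 2 * (z.re * w.re + z.im * w.im) + ‖z‖ ^ 2 * ‖w‖ ^ 2 := by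
    simp only [← Complex.normSq_eq_norm_sq, Complex.normSq_apply, Complex.sub_re, Complex.sub_im,
      Complex.mul_re, Complex.mul_im, Complex.conj_re, Complex.conj_im, Complex.one_re,
      Complex.one_im]
    ring
  have h4 : ‖1 - conj z * w‖ ^ 2 ≠ 0 := by positivity
  rw [e1]
  rw [e2] at h4 ⊢
  generalize ‖z‖ = s at *
  generalize ‖w‖ = t at *
  generalize z.re * w.re + z.im * w.im = d at *
  field_simp
  ring

/-- Exchanging the arms inverts the quotient, and an inverse is a positive multiple of the
conjugate, which has the same real part. -/
lemma discCos_comm (a b c : ℂ) : discCos a b c = discCos a c b := by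
  rw [discCos, discCos, ← inv_div (mob a b), Complex.inv_re, norm_inv, Complex.normSq_eq_norm_sq]
  rcases eq_or_ne ‖mob a b / mob a c‖ 0 with h | h
  · rw [h]; simp
  · field_simp

/-- The dual hyperbolic law of cosines, squared. -/
lemma dual_cos {x y z sx sy sz cA cB cC : ℝ} (hx : sx ^ 2 = x ^ 2 - 1) (hy : sy ^ 2 = y ^ 2 - 1)
    (hz : sz ^ 2 = z ^ 2 - 1) (px : 0 < sx) (py : 0 < sy) (pz : 0 < sz)
    (hA : x = y * z - sy * sz * cA) (hB : y = z * x - sz * sx * cB)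
    (hC : z = x * y - sx * sy * cC) :
    x ^ 2 * ((1 - cB ^ 2) * (1 - cC ^ 2)) = (cA + cB * cC) ^ 2 := by
  have eA : cA = (y * z - x) / (sy * sz) := by field_simp; linarith
  have eB : cB = (z * x - y) / (sz * sx) := by field_simp; linarith
  have eC : cC = (x * y - z) / (sx * sy) := by field_simp; linarith
  -- Up to sign, `D` is the Gram determinant of the triangle in the hyperboloid model. It is the
  -- numerator of each `1 - cos²`, and `cA + cB * cC` has numerator `x * D`, so `D²` cancels from
  -- both sides.
  set D := 1 + 2 * x * y * z - x ^ 2 - y ^ 2 - z ^ 2 with hD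
  have h1 : 1 - cB ^ 2 = D / (sz ^ 2 * sx ^ 2) := by
    rw [eB]; field_simp; rw [hz, hx]; ring
  have h2 : 1 - cC ^ 2 = D / (sx ^ 2 * sy ^ 2) := by
    rw [eC]; field_simp; rw [hy, hx]; ring
  have h3 : cA + cB * cC = x * D / (sx ^ 2 * sy * sz) := by
    rw [eA, eB, eC]; field_simp; rw [hx]; ring
  rw [h1, h2, h3]
  field_simp

/-- The angles of a hyperbolic triangle determine its sides. -/
lemma discCosh_eq_of_discCos_eq {a b c a' b' c' : ℂ} (ha : ‖a‖ < 1) (hb : ‖b‖ < 1) (hc : ‖c‖ < 1)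
    (ha' : ‖a'‖ < 1) (hb' : ‖b'‖ < 1) (hc' : ‖c'‖ < 1) (hab : a ≠ b) (hbc : b ≠ c) (hca : c ≠ a)
    (hab' : a' ≠ b') (hbc' : b' ≠ c') (hca' : c' ≠ a') (hA : discCos a b c = discCos a' b' c')
    (hB : discCos b c a = discCos b' c' a') (hC : discCos c a b = discCos c' a' b')
    (nB : discCos b c a ^ 2 ≠ 1) (nC : discCos c a b ^ 2 ≠ 1) :
    discCosh b c = discCosh b' c' := by
  have key : ∀ {a b c : ℂ}, ‖a‖ < 1 → ‖b‖ < 1 → ‖c‖ < 1 → a ≠ b → b ≠ c → c ≠ a →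
      discCosh b c ^ 2 * ((1 - discCos b c a ^ 2) * (1 - discCos c a b ^ 2)) =
        (discCos a b c + discCos b c a * discCos c a b) ^ 2 := by
    intro a b c ha hb hc hab hbc hca
    refine dual_cos (discSinh_sq hb hc) (discSinh_sq hc ha) (discSinh_sq ha hb)
      (discSinh_pos hb hc hbc) (discSinh_pos hc ha hca) (discSinh_pos ha hb hab) ?_ ?_ ?_
    · rw [discCosh_eq ha hb hc hab hca.symm, discCosh_comm c a, discSinh_comm c a]; ring
    · rw [discCosh_eq hb hc ha hbc hab.symm, discCosh_comm a b, discSinh_comm a b]; ring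
    · rw [discCosh_eq hc ha hb hca hbc.symm, discCosh_comm b c, discSinh_comm b c]; ring
  have h1 := key ha hb hc hab hbc hca
  have h2 := key ha' hb' hc' hab' hbc' hca'
  rw [← hA, ← hB, ← hC, ← h1] at h2
  -- The cancelled factor is the product of the squared sines of the angles at `b` and `c`; what
  -- remains are squares of positive numbers.
  have h3 := mul_right_cancel₀ (mul_ne_zero (sub_ne_zero.2 nB.symm) (sub_ne_zero.2 nC.symm)) h2
  rw [sq_eq_sq₀ (discCosh_pos hb' hc').le (discCosh_pos hb hc).le] at h3
  exact h3.symm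

/-! ### Linear isometries matching two pairs of vectors -/

/-- Two vectors are sent to two vectors of the same lengths and the same inner product by some
linear isometry of the plane. -/
lemma exists_linearIsometryEquiv {z w z' w' : ℂ} (hz : z ≠ 0) (h1 : ‖z‖ = ‖z'‖) (h2 : ‖w‖ = ‖w'‖)
    (h3 : (w / z).re = (w' / z').re) : ∃ T : ℂ ≃ₗᵢ[ℝ] ℂ, T z = z' ∧ T w = w' := by
  have hz' : z' ≠ 0 := norm_ne_zero_iff.1 (h1 ▸ norm_ne_zero_iff.2 hz)
  have h4 : ‖w / z‖ = ‖w' / z'‖ := by rw [norm_div, norm_div, h1, h2]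
  rw [← sq_eq_sq₀ (norm_nonneg _) (norm_nonneg _), ← Complex.normSq_eq_norm_sq,
    ← Complex.normSq_eq_norm_sq, Complex.normSq_apply, Complex.normSq_apply, h3,
    add_right_inj, mul_self_eq_mul_self_iff] at h4
  -- The quotients `w / z` and `w' / z'` are equal or conjugate. In the first case the rotation by
  -- `z' / z` works, in the second conjugation followed by the rotation by `z' / conj z`.
  rcases h4 with h4 | h4
  · have h5 : w / z = w' / z' := Complex.ext h3 h4
    have hu : ‖z' / z‖ = 1 := by rw [norm_div, h1, div_self (norm_ne_zero_iff.2 hz')]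
    obtain ⟨u, hu⟩ : ∃ u : Circle, (u : ℂ) = z' / z := ⟨⟨_, mem_sphere_zero_iff_norm.2 hu⟩, rfl⟩
    refine ⟨rotation u, ?_, ?_⟩
    · simp [rotation_apply, hu, hz]
    · rw [div_eq_div_iff hz hz'] at h5
      simp only [rotation_apply, hu]
      field_simp
      linear_combination h5
  · have h5 : conj (w / z) = w' / z' := Complex.ext h3 (by rw [Complex.conj_im, h4, neg_neg])
    have hcz : conj z ≠ 0 := by simpa using hz
    have hu : ‖z' / conj z‖ = 1 := by
      rw [norm_div, RCLike.norm_conj, h1, div_self (norm_ne_zero_iff.2 hz')]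
    obtain ⟨u, hu⟩ : ∃ u : Circle, (u : ℂ) = z' / conj z :=
      ⟨⟨_, mem_sphere_zero_iff_norm.2 hu⟩, rfl⟩
    refine ⟨Complex.conjLIE.trans (rotation u), ?_, ?_⟩
    · simp [rotation_apply, hu, hz]
    · rw [map_div₀, div_eq_div_iff hcz hz'] at h5
      simp only [LinearIsometryEquiv.trans_apply, Complex.conjLIE_apply, rotation_apply, hu]
      field_simp
      linear_combination h5

/-! ### Orthogonal clines and the collinearity determinant -/

/-- The determinant that vanishes when `p`, `q`, `x` lie on a cline perpendicular to the unit
circle. -/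
def perpDet (p q x : ℂ) : ℝ :=
  (p.re ^ 2 + p.im ^ 2 + 1) * (q.re * x.im - q.im * x.re)
    - (q.re ^ 2 + q.im ^ 2 + 1) * (p.re * x.im - p.im * x.re)
    + (x.re ^ 2 + x.im ^ 2 + 1) * (p.re * q.im - p.im * q.re)

/-- A matrix with a nonzero kernel vector is singular; the proof multiplies the determinant by each
entry of that vector and expands by cofactors. The third row serves both for a point and for the
derivative of a cline equation along a tangent vector. -/
lemma det_eq_zero_of_kernel {a b c x₁ y₁ z₁ x₂ y₂ z₂ x₃ y₃ z₃ : ℝ} (h : ¬ (a = 0 ∧ b = 0 ∧ c = 0))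
    (h₁ : a * x₁ + b * y₁ + c * z₁ = 0) (h₂ : a * x₂ + b * y₂ + c * z₂ = 0)
    (h₃ : a * x₃ + b * y₃ + c * z₃ = 0) :
    x₁ * (y₂ * z₃ - z₂ * y₃) - x₂ * (y₁ * z₃ - z₁ * y₃) + x₃ * (y₁ * z₂ - z₁ * y₂) = 0 := by
  by_contra hd
  have ha : a * (x₁ * (y₂ * z₃ - z₂ * y₃) - x₂ * (y₁ * z₃ - z₁ * y₃)
      + x₃ * (y₁ * z₂ - z₁ * y₂)) = 0 := by
    linear_combination (y₂ * z₃ - z₂ * y₃) * h₁ - (y₁ * z₃ - z₁ * y₃) * h₂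
      + (y₁ * z₂ - z₁ * y₂) * h₃
  have hb : b * (x₁ * (y₂ * z₃ - z₂ * y₃) - x₂ * (y₁ * z₃ - z₁ * y₃)
      + x₃ * (y₁ * z₂ - z₁ * y₂)) = 0 := by
    linear_combination -(x₂ * z₃ - z₂ * x₃) * h₁ + (x₁ * z₃ - z₁ * x₃) * h₂
      - (x₁ * z₂ - z₁ * x₂) * h₃
  have hc : c * (x₁ * (y₂ * z₃ - z₂ * y₃) - x₂ * (y₁ * z₃ - z₁ * y₃)
      + x₃ * (y₁ * z₂ - z₁ * y₂)) = 0 := by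
    linear_combination (x₂ * y₃ - y₂ * x₃) * h₁ - (x₁ * y₃ - y₁ * x₃) * h₂
      + (x₁ * y₂ - y₁ * x₂) * h₃
  exact h ⟨(mul_eq_zero.1 ha).resolve_right hd, (mul_eq_zero.1 hb).resolve_right hd,
    (mul_eq_zero.1 hc).resolve_right hd⟩

/-- A real denominator leaves the argument to the polynomial numerator. If the denominator vanishes,
both sides are `0`. -/
lemma mob_eq (a z : ℂ) :
    mob a z = (z - a) * (1 - a * conj z) / ((‖1 - conj a * z‖ ^ 2 : ℝ) : ℂ) := by
  rcases eq_or_ne (1 - conj a * z) 0 with h | h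
  · simp [mob, h]
  · have h' : 1 - a * conj z ≠ 0 := by
      rw [← norm_ne_zero_iff, norm_one_sub_mul_conj]
      exact norm_ne_zero_iff.2 h
    have e : ((‖1 - conj a * z‖ ^ 2 : ℝ) : ℂ) = (1 - conj a * z) * (1 - a * conj z) := by
      rw [Complex.ofReal_pow, ← Complex.mul_conj']
      simp
    rw [e, mob, mul_div_mul_right _ _ h']

/-- Once `p` is moved to the centre, the h-lines through it are diameters, so `q` and `x` are
h-collinear with `p` when their images are real-proportional. The identity ties this to `perpDet`.
-/
lemma im_mob_mul_conj_mob (p q x : ℂ) : (mob p x * conj (mob p q)).im =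
    (1 - ‖p‖ ^ 2) * perpDet p q x / (‖1 - conj p * x‖ ^ 2 * ‖1 - conj p * q‖ ^ 2) := by
  have e : mob p x * conj (mob p q) = ((x - p) * (1 - p * conj x) * (conj q - conj p)
      * (1 - conj p * q)) / ((‖1 - conj p * x‖ ^ 2 * ‖1 - conj p * q‖ ^ 2 : ℝ) : ℂ) := by
    rw [mob_eq, mob_eq, map_div₀, div_mul_div_comm, Complex.conj_ofReal, ← Complex.ofReal_mul]
    simp
    ring
  rw [e, Complex.div_ofReal_im]
  congr 1
  simp only [perpDet, ← Complex.normSq_eq_norm_sq, Complex.normSq_apply, Complex.sub_re,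
    Complex.sub_im, Complex.mul_re, Complex.mul_im, Complex.conj_re, Complex.conj_im,
    Complex.one_re, Complex.one_im]
  ring

/-! ### The unit coordinate and equations of orthogonal clines -/

/-- The affine coordinate in which `Ω` is the unit circle. -/
noncomputable def unitCoord (Ω : Sphere ℂ) (X : ℂ) : ℂ := (X - Ω.center) / (Ω.radius : ℂ)

lemma unitCoord_sub (Ω : Sphere ℂ) (X Y : ℂ) :
    unitCoord Ω X - unitCoord Ω Y = (X - Y) / (Ω.radius : ℂ) := by
  unfold unitCoord
  ring

lemma norm_unitCoord {Ω : Sphere ℂ} (hΩ : 0 < Ω.radius) (X : ℂ) :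
    ‖unitCoord Ω X‖ = dist X Ω.center / Ω.radius := by
  rw [unitCoord, norm_div, Complex.norm_real, Real.norm_of_nonneg hΩ.le, dist_eq_norm]

lemma norm_unitCoord_of_mem {Ω : Sphere ℂ} (hΩ : 0 < Ω.radius) {X : ℂ} (h : X ∈ Ω) :
    ‖unitCoord Ω X‖ = 1 := by
  rw [norm_unitCoord hΩ, EuclideanGeometry.mem_sphere.1 h, div_self hΩ.ne']

lemma dist_eq_unitCoord {Ω : Sphere ℂ} (hΩ : 0 < Ω.radius) (X Y : ℂ) :
    dist X Y = Ω.radius * ‖unitCoord Ω X - unitCoord Ω Y‖ := by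
  rw [unitCoord_sub, norm_div, Complex.norm_real, Real.norm_of_nonneg hΩ.le, dist_eq_norm]
  field_simp

lemma re_sub_eq_unitCoord {Ω : Sphere ℂ} (hΩ : 0 < Ω.radius) (X Y : ℂ) :
    X.re - Y.re = Ω.radius * ((unitCoord Ω X).re - (unitCoord Ω Y).re) := by
  rw [← Complex.sub_re, ← Complex.sub_re, unitCoord_sub, Complex.div_ofReal_re]
  field_simp

lemma im_sub_eq_unitCoord {Ω : Sphere ℂ} (hΩ : 0 < Ω.radius) (X Y : ℂ) :
    X.im - Y.im = Ω.radius * ((unitCoord Ω X).im - (unitCoord Ω Y).im) := by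
  rw [← Complex.sub_im, ← Complex.sub_im, unitCoord_sub, Complex.div_ofReal_im]
  field_simp

lemma unitCoord_center (Ω : Sphere ℂ) : unitCoord Ω Ω.center = 0 := by simp [unitCoord]

lemma unitCoord_injective {Ω : Sphere ℂ} (hΩ : 0 < Ω.radius) :
    Function.Injective (unitCoord Ω) := by
  intro X Y h
  have h1 := dist_eq_unitCoord hΩ X Y
  rwa [h, sub_self, norm_zero, mul_zero, dist_eq_zero] at h1

lemma mem_sphere_iff_unitCoord {Ω c : Sphere ℂ} (hΩ : 0 < Ω.radius) (hc : 0 < c.radius) (X : ℂ) :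
    X ∈ c ↔ Ω.radius ^ 2 * (((unitCoord Ω X).re - (unitCoord Ω c.center).re) ^ 2
      + ((unitCoord Ω X).im - (unitCoord Ω c.center).im) ^ 2) = c.radius ^ 2 := by
  rw [EuclideanGeometry.mem_sphere, ← sq_eq_sq₀ dist_nonneg hc.le, dist_eq_unitCoord hΩ, mul_pow,
    ← Complex.normSq_eq_norm_sq, Complex.normSq_apply, Complex.sub_re, Complex.sub_im]
  simp only [sq]

/-- A cline perpendicular to the absolute is given by an equation in the unit coordinate, and the
directions tangent to it are annihilated by the derivative of this equation. -/
lemma exists_equation {Ω : Sphere ℂ} (hΩ : 0 < Ω.radius) {Γ : Cline} (h : Γ.IsPerp Ω) :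
    ∃ a b c : ℝ, ¬ (a = 0 ∧ b = 0 ∧ c = 0) ∧
      (∀ X, X ∈ Γ.points ↔ a * ((unitCoord Ω X).re ^ 2 + (unitCoord Ω X).im ^ 2 + 1)
        + b * (unitCoord Ω X).re + c * (unitCoord Ω X).im = 0) ∧
      (∀ X v : ℂ, v ∈ (Γ.tangentLine X).direction →
        a * (2 * ((unitCoord Ω X).re * v.re + (unitCoord Ω X).im * v.im))
        + b * v.re + c * v.im = 0) := by
  match Γ, h with
  | .circle s hs, h =>
    have h1 := HPlane.perp_circle h
    rw [re_sub_eq_unitCoord hΩ, im_sub_eq_unitCoord hΩ, unitCoord_center] at h1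
    -- Orthogonality says that the power of the centre of `Ω` with respect to the circle is
    -- `Ω.radius ^ 2`; in the unit coordinate the constant term is therefore `1`.
    refine ⟨1, -2 * (unitCoord Ω s.center).re, -2 * (unitCoord Ω s.center).im, by simp, ?_, ?_⟩
    · intro X
      refine (mem_sphere_iff_unitCoord hΩ hs X).trans ?_
      simp only [Complex.zero_re, Complex.zero_im] at h1
      have hr : Ω.radius ^ 2 ≠ 0 := by positivity
      constructor <;> intro h2
      · refine mul_left_cancel₀ hr ?_
        linear_combination h2 - h1
      · linear_combination Ω.radius ^ 2 * h2 + h1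
    · intro X v hv
      simp only [Cline.tangentLine, Sphere.direction_orthRadius, vsub_eq_sub,
        Submodule.mem_orthogonal_singleton_iff_inner_right, Complex.inner, Complex.mul_re,
        Complex.conj_re, Complex.conj_im, Complex.sub_re, Complex.sub_im] at hv
      rw [re_sub_eq_unitCoord hΩ, im_sub_eq_unitCoord hΩ] at hv
      rw [← mul_right_inj' hΩ.ne', mul_zero]
      linear_combination 2 * hv
  | .line l hl, h =>
    have h1 := HPlane.center_mem_of_perp_line h
    obtain ⟨u, hu, hd⟩ := HPlane.exists_unit hl
    have hu2 : u.re ^ 2 + u.im ^ 2 = 1 := by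
      have := Complex.normSq_eq_norm_sq u
      rw [hu, Complex.normSq_apply] at this
      linarith
    have hmem : ∀ v : ℂ, v ∈ l.direction ↔ -u.im * v.re + u.re * v.im = 0 := by
      intro v
      rw [hd, Submodule.mem_span_singleton]
      constructor
      · rintro ⟨t, rfl⟩
        simp
        ring
      · intro h2
        refine ⟨u.re * v.re + u.im * v.im, Complex.ext ?_ ?_⟩
        · simp
          linear_combination v.re * hu2 + u.im * h2
        · simp
          linear_combination v.im * hu2 - u.re * h2
    -- The line passes through the centre, so its equation is homogeneous, with the normal obtained
    -- by turning `u` by a right angle.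
    refine ⟨0, -u.im, u.re, ?_, ?_, ?_⟩
    · rintro ⟨-, h2, h3⟩
      rw [neg_eq_zero] at h2
      rw [h2, h3] at hu2
      norm_num at hu2
    · intro X
      change X ∈ l ↔ _
      rw [← AffineSubspace.vsub_right_mem_direction_iff_mem h1 X, hmem, vsub_eq_sub,
        Complex.sub_re, Complex.sub_im, re_sub_eq_unitCoord hΩ, im_sub_eq_unitCoord hΩ,
        unitCoord_center, Complex.zero_re, Complex.zero_im]
      constructor <;> intro h2
      · refine mul_left_cancel₀ hΩ.ne' ?_
        linear_combination h2
      · linear_combination Ω.radius * h2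
    · intro X v hv
      have := (hmem v).1 hv
      linarith

/-! ### Tangents, angles and distances of the h-plane in the disc -/

namespace HPlane

/-- The point of the unit disc that corresponds to a point of the h-plane. -/
noncomputable def coord {Ω : Sphere ℂ} (P : HPlane Ω) : ℂ := unitCoord Ω P

lemma norm_coord_lt_one {Ω : Sphere ℂ} (P : HPlane Ω) : ‖P.coord‖ < 1 := by
  rw [coord, norm_unitCoord (radius_pos P), div_lt_one (radius_pos P)]
  exact P.2

lemma coord_injective {Ω : Sphere ℂ} : Function.Injective (coord (Ω := Ω)) :=
  fun P _ h => Subtype.ext (unitCoord_injective (radius_pos P) h)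

lemma perpDet_eq_zero {Ω : Sphere ℂ} (hΩ : 0 < Ω.radius) {Γ : Cline} (h : Γ.IsPerp Ω) {X Y Z : ℂ}
    (hX : X ∈ Γ.points) (hY : Y ∈ Γ.points) (hZ : Z ∈ Γ.points) :
    perpDet (unitCoord Ω X) (unitCoord Ω Y) (unitCoord Ω Z) = 0 := by
  obtain ⟨a, b, c, h0, h1, -⟩ := exists_equation hΩ h
  exact det_eq_zero_of_kernel h0 ((h1 X).1 hX) ((h1 Y).1 hY) ((h1 Z).1 hZ)

/-- The tangent direction of an h-segment is the direction of the Möbius coordinate. -/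
lemma exists_hTangent_eq {Ω : Sphere ℂ} {P Q : HPlane Ω} (h : P ≠ Q) :
    ∃ t : ℝ, 0 < t ∧ hTangent Q P = t * mob Q.coord P.coord := by
  have hΩ := radius_pos P
  obtain ⟨hperp, hP, hQ⟩ := hCline_spec P Q h
  obtain ⟨hv, hpos⟩ := (exists_tangent h hperp hP hQ).choose_spec
  have hT : hTangent Q P = (exists_tangent h hperp hP hQ).choose := by
    rw [hTangent, dif_neg h]
  rw [← hT] at hv hpos
  generalize hTangent Q P = v at hv hpos
  obtain ⟨a, b, c, h0, h1, h2⟩ := exists_equation hΩ hperp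
  -- The third row is the derivative of the equation at `Q` along `v`, not a third point.
  have hdet := det_eq_zero_of_kernel h0 ((h1 _).1 hP) ((h1 _).1 hQ) (h2 Q v hv)
  have hp := norm_coord_lt_one P
  have hq := norm_coord_lt_one Q
  have hne : Q.coord ≠ P.coord := fun e => h (coord_injective e.symm)
  have hpos' : 0 < v.re * (P.coord.re - Q.coord.re) + v.im * (P.coord.im - Q.coord.im) := by
    simp only [Complex.inner, Complex.mul_re, Complex.conj_re, Complex.conj_im, Complex.sub_re,
      Complex.sub_im] at hpos
    rw [re_sub_eq_unitCoord hΩ, im_sub_eq_unitCoord hΩ] at hpos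
    refine pos_of_mul_pos_right (a := Ω.radius) ?_ hΩ.le
    change 0 < Ω.radius * (v.re * ((unitCoord Ω P).re - (unitCoord Ω Q).re)
      + v.im * ((unitCoord Ω P).im - (unitCoord Ω Q).im))
    linarith
  change (P.coord.re ^ 2 + P.coord.im ^ 2 + 1) *
      (Q.coord.re * v.im - Q.coord.im * v.re) -
      (Q.coord.re ^ 2 + Q.coord.im ^ 2 + 1) * (P.coord.re * v.im - P.coord.im * v.re) +
      2 * (Q.coord.re * v.re + Q.coord.im * v.im) *
      (P.coord.re * Q.coord.im - P.coord.im * Q.coord.re) = 0 at hdet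
  generalize P.coord = p at *
  generalize Q.coord = q at *
  have hD := one_sub_conj_mul_ne_zero hq hp.le
  have hre : 0 < (1 - conj q * p).re := by
    have h3 : (conj q * p).re ≤ ‖conj q * p‖ := Complex.re_le_norm _
    rw [norm_mul, RCLike.norm_conj] at h3
    rw [Complex.sub_re, Complex.one_re]
    nlinarith [norm_nonneg q, norm_nonneg p]
  -- Up to the positive factor `‖p - q‖ ^ 2`, this product is `v / mob q p`. The determinant shows
  -- that it is real; the acute angle between `v` and the chord, with `hre`, makes it positive.
  have him : (v * (conj (p - q) * (1 - conj q * p))).im = 0 := by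
    simp only [map_sub, Complex.sub_re, Complex.sub_im, Complex.mul_re, Complex.mul_im,
      Complex.conj_re, Complex.conj_im, Complex.one_re, Complex.one_im]
    linear_combination -hdet
  have hc0 : conj (p - q) * (1 - conj q * p) ≠ 0 :=
    mul_ne_zero ((map_ne_zero _).2 (sub_ne_zero.2 hne.symm)) hD
  obtain ⟨s, hs⟩ : ∃ s : ℝ, v * (conj (p - q) * (1 - conj q * p)) = s :=
    ⟨_, (Complex.ext rfl (by simpa using him))⟩
  have hn := norm_pos_iff.2 hD
  have hn2 := norm_pos_iff.2 (sub_ne_zero.2 hne.symm)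
  have hs' : (v * conj (p - q)) * ((‖1 - conj q * p‖ ^ 2 : ℝ) : ℂ)
      = s * (conj (1 - conj q * p)) := by
    rw [← hs, Complex.ofReal_pow, ← Complex.mul_conj']
    ring
  have hspos : 0 < s := by
    have h4 := congrArg Complex.re hs'
    rw [Complex.re_mul_ofReal, Complex.re_ofReal_mul, Complex.conj_re] at h4
    have h5 : (v * conj (p - q)).re = v.re * (p.re - q.re) + v.im * (p.im - q.im) := by
      simp
      ring
    rw [h5] at h4
    have h6 : 0 < s * (1 - conj q * p).re := by
      rw [← h4]
      positivity
    exact pos_of_mul_pos_left h6 hre.le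
  refine ⟨s / ‖p - q‖ ^ 2, by positivity, ?_⟩
  have hpq : conj (p - q) ≠ 0 := left_ne_zero_of_mul hc0
  have hpq' : p - q ≠ 0 := sub_ne_zero.2 hne.symm
  rw [Complex.ofReal_div, ← hs, Complex.ofReal_pow, ← Complex.mul_conj', mob, div_mul_div_comm,
    eq_div_iff (mul_ne_zero (mul_ne_zero hpq' hpq) hD)]
  ring

/-- The positive factors from `exists_hTangent_eq` do not affect the argument. -/
lemma hAngle_eq {Ω : Sphere ℂ} {P Q R : HPlane Ω} (hP : P ≠ Q) (hR : R ≠ Q) :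
    hAngle P Q R = Complex.arg (mob Q.coord R.coord / mob Q.coord P.coord) := by
  obtain ⟨t, ht, e⟩ := exists_hTangent_eq hP
  obtain ⟨s, hs, e'⟩ := exists_hTangent_eq hR
  rw [hAngle, e, e', mul_div_mul_comm, ← Complex.ofReal_div, Complex.arg_real_mul _ (div_pos hs ht)]

lemma cos_hAngle {Ω : Sphere ℂ} {P Q R : HPlane Ω} (hP : P ≠ Q) (hR : R ≠ Q) :
    Real.cos (hAngle P Q R) = discCos Q.coord P.coord R.coord := by
  have hne : ∀ {X : HPlane Ω}, X ≠ Q → mob Q.coord X.coord ≠ 0 := fun {X} h =>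
    mob_ne_zero (norm_coord_lt_one Q) (norm_coord_lt_one X).le fun e => h (coord_injective e.symm)
  rw [hAngle_eq hP hR, Complex.cos_arg (div_ne_zero (hne hR) (hne hP)), discCos]

/-- The determinant of a nondegenerate h-triangle does not vanish. -/
lemma perpDet_ne_zero {Ω : Sphere ℂ} {A B C : HPlane Ω} (h : IsNondegenerate A B C) :
    perpDet A.coord B.coord C.coord ≠ 0 := by
  intro hd
  obtain ⟨hAB, -, -, hl⟩ := h
  obtain ⟨hperp, hA, hB⟩ := hCline_spec A B hAB
  have hΩ := radius_pos A
  refine hl ⟨_, ⟨_, hperp, rfl⟩, hA, hB, ?_⟩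
  obtain ⟨a, b, c, h0, h1, -⟩ := exists_equation hΩ hperp
  refine (h1 C).2 ?_
  have eA := (h1 A).1 hA
  have eB := (h1 B).1 hB
  have hne : A.coord ≠ B.coord := fun e => hAB (coord_injective e)
  have nA := pow_lt_one₀ (norm_nonneg _) (norm_coord_lt_one A) two_ne_zero
  have nB := pow_lt_one₀ (norm_nonneg _) (norm_coord_lt_one B) two_ne_zero
  rw [← Complex.normSq_eq_norm_sq, Complex.normSq_apply] at nA nB
  change a * (A.coord.re ^ 2 + A.coord.im ^ 2 + 1) + b * A.coord.re + c * A.coord.im = 0 at eA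
  change a * (B.coord.re ^ 2 + B.coord.im ^ 2 + 1) + b * B.coord.re + c * B.coord.im = 0 at eB
  change a * (C.coord.re ^ 2 + C.coord.im ^ 2 + 1) + b * C.coord.re + c * C.coord.im = 0
  rw [perpDet] at hd
  generalize A.coord = p at *
  generalize B.coord = q at *
  generalize C.coord = x at *
  -- If the equation of the cline through `A` and `B` fails at `C`, then multiplying by its value
  -- there shows that all 2×2 minors of the rows of `A` and `B` vanish, so these rows are
  -- proportional.
  by_contra hL
  set S := p.re ^ 2 + p.im ^ 2 + 1 with hS
  set T := q.re ^ 2 + q.im ^ 2 + 1 with hT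
  set U := x.re ^ 2 + x.im ^ 2 + 1 with hU
  have k1 : p.re * q.im - p.im * q.re = 0 := by
    refine (mul_eq_zero.1 (?_ : (a * U + b * x.re + c * x.im) * _ = 0)).resolve_left hL
    linear_combination a * hd - (q.re * x.im - q.im * x.re) * eA + (p.re * x.im - p.im * x.re) * eB
  have k2 : S * q.im - T * p.im = 0 := by
    refine (mul_eq_zero.1 (?_ : (a * U + b * x.re + c * x.im) * _ = 0)).resolve_left hL
    linear_combination -b * hd + (U * q.im - T * x.im) * eA - (U * p.im - S * x.im) * eB
  have k3 : S * q.re - T * p.re = 0 := by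
    refine (mul_eq_zero.1 (?_ : (a * U + b * x.re + c * x.im) * _ = 0)).resolve_left hL
    linear_combination c * hd + (U * q.re - T * x.re) * eA - (U * p.re - S * x.re) * eB
  have k4 : T ^ 2 * (S - 1) = S ^ 2 * (T - 1) := by
    have e1 : T * p.re = S * q.re := by linarith
    have e2 : T * p.im = S * q.im := by linarith
    linear_combination T ^ 2 * hS - S ^ 2 * hT + (T * p.re + S * q.re) * e1
      + (T * p.im + S * q.im) * e2
  have k5 : (S - T) * (S * T - S - T) = 0 := by linear_combination -k4
  -- The other factor vanishes only when `‖p‖ * ‖q‖ = 1`, as for points inverse in the unit circle;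
  -- this is impossible inside the disc.
  have hST : S = T := by
    rcases mul_eq_zero.1 k5 with k | k
    · linarith
    · nlinarith [sq_nonneg p.re, sq_nonneg p.im, sq_nonneg q.re, sq_nonneg q.im]
  have hT0 : T ≠ 0 := by positivity
  rw [hST, ← mul_sub] at k2 k3
  exact hne (Complex.ext (by linarith [(mul_eq_zero.1 k3).resolve_left hT0])
    (by linarith [(mul_eq_zero.1 k2).resolve_left hT0]))

/-- A cosine of `±1` makes `mob a c / mob a b` real, and by `im_mob_mul_conj_mob` this forces
`perpDet a b c = 0`. -/
lemma discCos_sq_ne_one {a b c : ℂ} (ha : ‖a‖ < 1) (hb : ‖b‖ < 1) (hc : ‖c‖ < 1) (hab : a ≠ b)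
    (hac : a ≠ c) (h : perpDet a b c ≠ 0) : discCos a b c ^ 2 ≠ 1 := by
  intro h1
  have hz := mob_ne_zero ha hb.le hab
  have hw := mob_ne_zero ha hc.le hac
  have h2 : (mob a c / mob a b).im = 0 := by
    have h3 := norm_ne_zero_iff.2 (div_ne_zero hw hz)
    rw [discCos, div_pow, div_eq_one_iff_eq (pow_ne_zero 2 h3), ← Complex.normSq_eq_norm_sq,
      Complex.normSq_apply] at h1
    refine pow_eq_zero_iff two_ne_zero |>.1 ?_
    linarith
  have h3 : (mob a c * conj (mob a b)).im = 0 := by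
    have e : mob a c * conj (mob a b) = (mob a c / mob a b) * ((‖mob a b‖ ^ 2 : ℝ) : ℂ) := by
      rw [Complex.ofReal_pow, ← Complex.mul_conj']
      field_simp
    rw [e, Complex.im_mul_ofReal, h2, zero_mul]
  rw [im_mob_mul_conj_mob] at h3
  have h4 := norm_ne_zero_iff.2 (one_sub_conj_mul_ne_zero ha hb.le)
  have h5 := norm_ne_zero_iff.2 (one_sub_conj_mul_ne_zero ha hc.le)
  have h6 := (sub_pos.2 (pow_lt_one₀ (norm_nonneg a) ha two_ne_zero)).ne'
  exact div_ne_zero (mul_ne_zero h6 h) (mul_ne_zero (pow_ne_zero 2 h5) (pow_ne_zero 2 h4)) h3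

/-- A unit complex number that is a real multiple of `w` is `w / ‖w‖` or its opposite. -/
lemma eq_or_eq_neg_of_im_mul_conj {w z : ℂ} (hw : w ≠ 0) (hz : ‖z‖ = 1)
    (h : (z * conj w).im = 0) : z = w / ‖w‖ ∨ z = -(w / ‖w‖) := by
  have hn := norm_ne_zero_iff.2 hw
  have hn' : (‖w‖ : ℂ) ≠ 0 := Complex.ofReal_ne_zero.2 hn
  obtain ⟨s, hs⟩ : ∃ s : ℝ, z * conj w = s := ⟨_, Complex.ext rfl (by simpa using h)⟩
  have h1 : |s| = ‖w‖ := by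
    rw [← Real.norm_eq_abs, ← Complex.norm_real, ← hs, norm_mul, hz, RCLike.norm_conj, one_mul]
  have h2 : z * (‖w‖ * ‖w‖) = s * w := by
    rw [← hs, mul_assoc, mul_comm _ w, Complex.mul_conj', sq]
  rcases abs_eq (norm_nonneg w) |>.1 h1 with e | e
  · left
    rw [e] at h2
    rw [eq_div_iff hn']
    exact mul_right_cancel₀ hn' (by linear_combination h2)
  · right
    rw [e, Complex.ofReal_neg] at h2
    rw [← neg_div, eq_div_iff hn']
    exact mul_right_cancel₀ hn' (by linear_combination h2)

/-- The h-distance in terms of the pseudo-hyperbolic distance. -/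
lemma hDist_eq {Ω : Sphere ℂ} (P Q : HPlane Ω) :
    hDist P Q = |Real.log ((1 + ‖mob P.coord Q.coord‖) / (1 - ‖mob P.coord Q.coord‖))| := by
  rcases eq_or_ne P Q with h | h
  · simp [hDist, h, mob_self]
  have hΩ := radius_pos P
  obtain ⟨hperp, hP, hQ⟩ := hCline_spec P Q h
  obtain ⟨hne, hAB⟩ := ideal_spec P Q h
  have hA : idealA P Q h ∈ (hCline P Q h).points ∩ (Ω : Set ℂ) := by rw [hAB]; simp
  have hB : idealB P Q h ∈ (hCline P Q h).points ∩ (Ω : Set ℂ) := by rw [hAB]; simp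
  have dA := perpDet_eq_zero hΩ hperp hP hQ hA.1
  have dB := perpDet_eq_zero hΩ hperp hP hQ hB.1
  have nA := norm_unitCoord_of_mem hΩ hA.2
  have nB := norm_unitCoord_of_mem hΩ hB.2
  have hne' : unitCoord Ω (idealA P Q h) ≠ unitCoord Ω (idealB P Q h) :=
    fun e => hne (unitCoord_injective hΩ e)
  have hp := norm_coord_lt_one P
  have hq := norm_coord_lt_one Q
  have hpq : P.coord ≠ Q.coord := fun e => h (coord_injective e)
  rw [hDist, dif_neg h]
  simp only [dist_eq_unitCoord hΩ]
  change perpDet P.coord Q.coord _ = 0 at dA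
  change perpDet P.coord Q.coord _ = 0 at dB
  change |Real.log ((Ω.radius * ‖unitCoord Ω (idealA P Q h) - Q.coord‖
    * (Ω.radius * ‖unitCoord Ω (idealB P Q h) - P.coord‖)) /
    (Ω.radius * ‖Q.coord - unitCoord Ω (idealB P Q h)‖
      * (Ω.radius * ‖P.coord - unitCoord Ω (idealA P Q h)‖)))| = _
  generalize unitCoord Ω (idealA P Q h) = α at *
  generalize unitCoord Ω (idealB P Q h) = β at *
  generalize P.coord = p at *
  generalize Q.coord = q at *
  have iA := im_mob_mul_conj_mob p q α
  have iB := im_mob_mul_conj_mob p q β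
  rw [dA, mul_zero, zero_div] at iA
  rw [dB, mul_zero, zero_div] at iB
  have mA := norm_mob_eq_one hp nA
  have mB := norm_mob_eq_one hp nB
  have hw := mob_ne_zero hp hq.le hpq
  have hAB' : mob p α ≠ mob p β := fun e => hne' (by
    rw [← mob_neg_mob hp nA.le, e, mob_neg_mob hp nB.le])
  -- The cross-ratio is transported by `mob p`. The two factors involving `P` become distances from
  -- the centre to the unit circle, that is `1`.
  have cross : (Ω.radius * ‖α - q‖ * (Ω.radius * ‖β - p‖)) /
      (Ω.radius * ‖q - β‖ * (Ω.radius * ‖p - α‖))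
      = ‖mob p α - mob p q‖ / ‖mob p q - mob p β‖ := by
    have e1 : ‖β - p‖ = ‖1 - conj p * β‖ := by
      rw [mob, norm_div, div_eq_one_iff_eq
        (norm_ne_zero_iff.2 (one_sub_conj_mul_ne_zero hp nB.le))] at mB
      exact mB
    have e2 : ‖p - α‖ = ‖1 - conj p * α‖ := by
      rw [mob, norm_div, div_eq_one_iff_eq
        (norm_ne_zero_iff.2 (one_sub_conj_mul_ne_zero hp nA.le))] at mA
      rw [norm_sub_rev, mA]
    have n1 := norm_ne_zero_iff.2 (one_sub_conj_mul_ne_zero hp nA.le)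
    have n2 := norm_ne_zero_iff.2 (one_sub_conj_mul_ne_zero hp nB.le)
    have n3 := norm_ne_zero_iff.2 (one_sub_conj_mul_ne_zero hp hq.le)
    have n4 := norm_ne_zero_iff.2 (one_sub_conj_mul_self_ne_zero hp)
    have n5 : ‖q - β‖ ≠ 0 := by
      rw [norm_ne_zero_iff, sub_ne_zero]
      rintro rfl
      exact hq.ne nB
    rw [mob_sub_mob hp nA.le hq.le, mob_sub_mob hp hq.le nB.le, e1, e2]
    simp only [norm_div, norm_mul]
    generalize ‖1 - conj p * α‖ = x₁ at *
    generalize ‖1 - conj p * β‖ = x₂ at *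
    generalize ‖1 - conj p * q‖ = x₃ at *
    generalize ‖1 - conj p * p‖ = x₄ at *
    field_simp
  rw [cross]
  have hw1 := norm_mob_lt_one hp hq
  have hn := norm_pos_iff.2 hw
  have plus : ‖mob p q / ‖mob p q‖ + mob p q‖ = 1 + ‖mob p q‖ := by
    have e : mob p q / ‖mob p q‖ + mob p q
        = mob p q / ‖mob p q‖ * ((1 + ‖mob p q‖ : ℝ) : ℂ) := by
      have : (‖mob p q‖ : ℂ) ≠ 0 := Complex.ofReal_ne_zero.2 hn.ne'
      push_cast
      field_simp
    rw [e, norm_mul, norm_div, Complex.norm_real, Complex.norm_real, norm_norm, div_self hn.ne',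
      one_mul, Real.norm_of_nonneg (by positivity)]
  have minus : ‖mob p q / ‖mob p q‖ - mob p q‖ = 1 - ‖mob p q‖ := by
    have e : mob p q / ‖mob p q‖ - mob p q
        = mob p q / ‖mob p q‖ * ((1 - ‖mob p q‖ : ℝ) : ℂ) := by
      have : (‖mob p q‖ : ℂ) ≠ 0 := Complex.ofReal_ne_zero.2 hn.ne'
      push_cast
      field_simp
    rw [e, norm_mul, norm_div, Complex.norm_real, Complex.norm_real, norm_norm, div_self hn.ne',
      one_mul, Real.norm_of_nonneg (by linarith)]
  have plus' : ‖-(mob p q / ‖mob p q‖) - mob p q‖ = 1 + ‖mob p q‖ := by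
    rw [← plus, ← norm_neg]
    congr 1
    ring
  have minus' : ‖mob p q - mob p q / ‖mob p q‖‖ = 1 - ‖mob p q‖ := by
    rw [norm_sub_rev, minus]
  have plus'' : ‖mob p q - -(mob p q / ‖mob p q‖)‖ = 1 + ‖mob p q‖ := by
    rw [norm_sub_rev, plus']
  -- The images of the ideal points are the two ends of the diameter through `mob p q`. Equal ends
  -- contradict `hAB'`; the two remaining labellings give reciprocal ratios, which the absolute
  -- value identifies.
  rcases eq_or_eq_neg_of_im_mul_conj hw mA iA with eA | eA <;>
    rcases eq_or_eq_neg_of_im_mul_conj hw mB iB with eB | eB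
  · exact absurd (eA.trans eB.symm) hAB'
  · rw [eA, eB, minus, plus'', ← inv_div, Real.log_inv, abs_neg]
  · rw [eA, eB, plus', minus']
  · exact absurd (eA.trans eB.symm) hAB'

/-! ### Motions induced by maps of the disc -/

/-- The point of the h-plane with a given coordinate in the unit disc. -/
noncomputable def ofCoord {Ω : Sphere ℂ} (hΩ : 0 < Ω.radius) (z : ℂ) (hz : ‖z‖ < 1) : HPlane Ω :=
  ⟨Ω.center + Ω.radius * z, by
    rw [dist_eq_norm, add_sub_cancel_left, norm_mul, Complex.norm_real,
      Real.norm_of_nonneg hΩ.le]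
    exact mul_lt_of_lt_one_right hΩ hz⟩

lemma coord_ofCoord {Ω : Sphere ℂ} (hΩ : 0 < Ω.radius) (z : ℂ) (hz : ‖z‖ < 1) :
    (ofCoord hΩ z hz).coord = z := by
  have : (Ω.radius : ℂ) ≠ 0 := Complex.ofReal_ne_zero.2 hΩ.ne'
  simp [coord, ofCoord, unitCoord, this]

/-- The h-plane is in bijection with itself by a pair of mutually inverse maps of the unit disc. -/
noncomputable def equivOfDisc {Ω : Sphere ℂ} (hΩ : 0 < Ω.radius) (f g : ℂ → ℂ)
    (hf : ∀ z, ‖z‖ < 1 → ‖f z‖ < 1) (hg : ∀ z, ‖z‖ < 1 → ‖g z‖ < 1)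
    (hgf : ∀ z, ‖z‖ < 1 → g (f z) = z) (hfg : ∀ z, ‖z‖ < 1 → f (g z) = z) :
    HPlane Ω ≃ HPlane Ω where
  toFun P := ofCoord hΩ (f P.coord) (hf _ (norm_coord_lt_one P))
  invFun P := ofCoord hΩ (g P.coord) (hg _ (norm_coord_lt_one P))
  left_inv P := coord_injective (by
    rw [coord_ofCoord, coord_ofCoord, hgf _ (norm_coord_lt_one P)])
  right_inv P := coord_injective (by
    rw [coord_ofCoord, coord_ofCoord, hfg _ (norm_coord_lt_one P)])

lemma coord_equivOfDisc {Ω : Sphere ℂ} (hΩ : 0 < Ω.radius) (f g : ℂ → ℂ)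
    (hf : ∀ z, ‖z‖ < 1 → ‖f z‖ < 1) (hg : ∀ z, ‖z‖ < 1 → ‖g z‖ < 1)
    (hgf : ∀ z, ‖z‖ < 1 → g (f z) = z) (hfg : ∀ z, ‖z‖ < 1 → f (g z) = z) (P : HPlane Ω) :
    (equivOfDisc hΩ f g hf hg hgf hfg P).coord = f P.coord :=
  coord_ofCoord hΩ _ (hf _ (norm_coord_lt_one P))

lemma isMotion_of_norm_mob {Ω : Sphere ℂ} (e : HPlane Ω ≃ HPlane Ω)
    (h : ∀ P Q, ‖mob (e P).coord (e Q).coord‖ = ‖mob P.coord Q.coord‖) : IsMotion e :=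
  ⟨e.bijective, fun P Q => by rw [hDist_eq, hDist_eq, h]⟩

lemma IsMotion.comp {Ω : Sphere ℂ} {f g : HPlane Ω → HPlane Ω} (hf : IsMotion f)
    (hg : IsMotion g) : IsMotion (f ∘ g) :=
  ⟨hf.1.comp hg.1, fun P Q => (hf.2 _ _).trans (hg.2 P Q)⟩

lemma IsMotion.symm {Ω : Sphere ℂ} {e : HPlane Ω ≃ HPlane Ω} (he : IsMotion e) :
    IsMotion e.symm :=
  ⟨e.symm.bijective, fun P Q => by rw [← he.2, e.apply_symm_apply, e.apply_symm_apply]⟩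

/-- There is a motion that acts as the Möbius transformation `mob A.coord`. -/
lemma exists_motion_mob {Ω : Sphere ℂ} (A : HPlane Ω) :
    ∃ e : HPlane Ω ≃ HPlane Ω, IsMotion e ∧ ∀ P, (e P).coord = mob A.coord P.coord := by
  have ha := norm_coord_lt_one A
  have ha' : ‖-A.coord‖ < 1 := by rwa [norm_neg]
  refine ⟨equivOfDisc (radius_pos A) (mob A.coord) (mob (-A.coord))
    (fun z hz => norm_mob_lt_one ha hz) (fun z hz => norm_mob_lt_one ha' hz)
    (fun z hz => mob_neg_mob ha hz.le) (fun z hz => ?_), ?_, fun P => coord_equivOfDisc ..⟩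
  · simpa using mob_neg_mob ha' hz.le
  · refine isMotion_of_norm_mob _ fun P Q => ?_
    rw [coord_equivOfDisc, coord_equivOfDisc,
      norm_mob_mob ha (norm_coord_lt_one P) (norm_coord_lt_one Q)]

/-- There is a motion that acts as a given linear isometry. -/
lemma exists_motion_linearIsometryEquiv {Ω : Sphere ℂ} (hΩ : 0 < Ω.radius) (T : ℂ ≃ₗᵢ[ℝ] ℂ) :
    ∃ e : HPlane Ω ≃ HPlane Ω, IsMotion e ∧ ∀ P, (e P).coord = T P.coord := by
  refine ⟨equivOfDisc hΩ T T.symm (fun z hz => by rwa [T.norm_map])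
    (fun z hz => by rwa [T.symm.norm_map]) (fun z _ => T.symm_apply_apply z)
    (fun z _ => T.apply_symm_apply z), ?_, fun P => coord_equivOfDisc ..⟩
  refine isMotion_of_norm_mob _ fun P Q => ?_
  rw [coord_equivOfDisc, coord_equivOfDisc, norm_mob_map]

/-! ### From equal angles to congruence -/

/-- Triangles with equal angles, up to sign, have equal cosines of angles. -/
lemma discCos_eq_of_hAngle {Ω : Sphere ℂ} {P Q R P' Q' R' : HPlane Ω} (hP : P ≠ Q) (hR : R ≠ Q)
    (hP' : P' ≠ Q') (hR' : R' ≠ Q')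
    (h : hAngle P Q R = hAngle P' Q' R' ∨ hAngle P Q R = -hAngle P' Q' R') :
    discCos Q.coord R.coord P.coord = discCos Q'.coord R'.coord P'.coord := by
  rw [discCos_comm, discCos_comm Q'.coord, ← cos_hAngle hP hR, ← cos_hAngle hP' hR']
  rcases h with h | h <;> rw [h]
  exact Real.cos_neg _

lemma perpDet_rotate (p q x : ℂ) : perpDet q x p = perpDet p q x := by
  unfold perpDet
  ring

/-- Two sides and the cosine of the angle between them determine an h-triangle up to congruence. -/
lemma isCongruent_of_discCos_eq {Ω : Sphere ℂ} {A B C A' B' C' : HPlane Ω} (hAB : A ≠ B)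
    (hb : ‖mob A.coord B.coord‖ = ‖mob A'.coord B'.coord‖)
    (hc : ‖mob A.coord C.coord‖ = ‖mob A'.coord C'.coord‖) (hAC : A ≠ C)
    (h : discCos A.coord B.coord C.coord = discCos A'.coord B'.coord C'.coord) :
    IsCongruent A B C A' B' C' := by
  have hne : ∀ {X : HPlane Ω}, A ≠ X → mob A.coord X.coord ≠ 0 := fun {X} h =>
    mob_ne_zero (norm_coord_lt_one A) (norm_coord_lt_one X).le fun e => h (coord_injective e)
  have hre : (mob A.coord C.coord / mob A.coord B.coord).re
      = (mob A'.coord C'.coord / mob A'.coord B'.coord).re := by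
    rw [discCos, discCos, norm_div, norm_div, ← hb, ← hc] at h
    exact (div_left_inj' (div_ne_zero (norm_ne_zero_iff.2 (hne hAC))
      (norm_ne_zero_iff.2 (hne hAB)))).1 h
  obtain ⟨T, hTB, hTC⟩ := exists_linearIsometryEquiv (hne hAB) hb hc hre
  obtain ⟨e, he, heq⟩ := exists_motion_mob A
  obtain ⟨e', he', heq'⟩ := exists_motion_mob A'
  obtain ⟨t, ht, hteq⟩ := exists_motion_linearIsometryEquiv (radius_pos A) T
  -- The vertex `A` goes to the centre, `T` aligns the two arms, and the centre goes to `A'`.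
  refine ⟨e'.symm ∘ (t ∘ e), he'.symm.comp (ht.comp he), ?_, ?_, ?_⟩
  all_goals
    refine (e'.symm_apply_eq.2 (coord_injective ?_)).symm
    rw [Function.comp_apply, hteq, heq, heq']
  · rw [mob_self, mob_self, map_zero]
  · exact hTB
  · exact hTC

theorem isCongruent_of_sameAngles {Ω : Sphere ℂ} {A B C A' B' C' : HPlane Ω}
    (h : IsNondegenerate A B C) (h' : IsNondegenerate A' B' C')
    (hs : SameAngles A B C A' B' C') : IsCongruent A B C A' B' C' := by
  have hd := perpDet_ne_zero h
  obtain ⟨hAB, hBC, hCA, -⟩ := h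
  obtain ⟨hAB', hBC', hCA', -⟩ := h'
  have cB := discCos_eq_of_hAngle hAB hBC.symm hAB' hBC'.symm hs.1
  have cC := discCos_eq_of_hAngle hBC hCA.symm hBC' hCA'.symm hs.2.1
  have cA := discCos_eq_of_hAngle hCA hAB.symm hCA' hAB'.symm hs.2.2
  have inj : ∀ {X Y : HPlane Ω}, X ≠ Y → X.coord ≠ Y.coord := fun h e => h (coord_injective e)
  have na := norm_coord_lt_one A
  have nb := norm_coord_lt_one B
  have nc := norm_coord_lt_one C
  have na' := norm_coord_lt_one A'
  have nb' := norm_coord_lt_one B'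
  have nc' := norm_coord_lt_one C'
  have sA := discCos_sq_ne_one na nb nc (inj hAB) (inj hCA.symm) hd
  have sB := discCos_sq_ne_one nb nc na (inj hBC) (inj hAB.symm) (by rwa [perpDet_rotate])
  have sC := discCos_sq_ne_one nc na nb (inj hCA) (inj hBC.symm)
    (by rwa [perpDet_rotate, perpDet_rotate])
  -- `eB` concerns the side `CA` and `eC` the side `AB`; these are the two sides enclosing the angle
  -- at `A`.
  have eB := discCosh_eq_of_discCos_eq nb nc na nb' nc' na' (inj hBC) (inj hCA) (inj hAB)
    (inj hBC') (inj hCA') (inj hAB') cB cC cA sC sA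
  have eC := discCosh_eq_of_discCos_eq nc na nb nc' na' nb' (inj hCA) (inj hAB) (inj hBC)
    (inj hCA') (inj hAB') (inj hBC') cC cA cB sA sB
  refine isCongruent_of_discCos_eq hAB (norm_mob_eq_of_discCosh_eq na nb na' nb' eC) ?_ hCA.symm cA
  rw [norm_mob_comm, norm_mob_comm A'.coord]
  exact norm_mob_eq_of_discCosh_eq nc na nc' na' eB

end HPlane

theorem mainTheorem8 (Ω : EuclideanGeometry.Sphere ℂ) (hΩ : 0 < Ω.radius) :
    (∀ A B C A' B' C' : HPlane Ω,
      HPlane.IsNondegenerate A B C → HPlane.IsNondegenerate A' B' C' →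
      HPlane.SameAngles A B C A' B' C' → HPlane.IsCongruent A B C A' B' C') ∧
    (∀ A B C A' B' C' : HPlane Ω,
      HPlane.IsNondegenerate A B C → HPlane.IsNondegenerate A' B' C' →
      HPlane.IsSimilar A B C A' B' C' → HPlane.IsCongruent A B C A' B' C') :=
  ⟨fun _ _ _ _ _ _ h h' hs => HPlane.isCongruent_of_sameAngles h h' hs,
    -- Only the angle part of similarity enters; the ratio of the sides is then forced.
    fun _ _ _ _ _ _ h h' hs => HPlane.isCongruent_of_sameAngles h h' hs.2⟩
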